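/- Let $H^2_2$ be the Drury--Arveson space of the unit ball of $\mathbb{C}^2$: the Hilbert space of analytic functions in which the monomials $z_1^mz_2^n$ are orthogonal and complete, with $\|z_1^mz_2^n\|^2=\binom{m+n}{m}^{-1}$. Let $k\ge 1$ be an integer, let $0<\epsilon<1$, and put $F:=\epsilon^{2/k}$. For $t\in\mathbb{R}$ let $I(t)=\langle z_1^k-\epsilon e^{it}\rangle\subseteq\mathbb{C}[z_1,z_2]$, let $I(t)^\perp$ be its orthogonal complement in $H^2_2$, and let $P_t$ be the orthogonal projection of $H^2_2$ onto $I(t)^\perp$. A flat section is a smooth map $\xi:\mathbb{R}\to H^2_2$ with $\xi(t)\in I(t)^\perp$ and $P_t\big(\tfrac{d\xi}{dt}(t)\big)=0$ for all $t\in\mathbb{R}$. Let $T_1,T_2$ be the compressions to $I(0)^\perp$ of the operators of multiplication by $z_1,z_2$ on $H^2_2$, and let $\mathfrak{T}_{I(0)}$ be the C*-algebra of bounded operators on $I(0)^\perp$ generated by $1$, $T_1$, $T_2$ and all compact operators. Then there is exactly one bounded operator $U$ on $I(0)^\perp=I(2\pi)^\perp$ such that $U\xi(0)=\xi(2\pi)$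 for every flat section $\xi$ (the monodromy operator $U=U_{2\pi}$). This operator $U$ is unitary, it satisfies $U^*\,\mathfrak{T}_{I(0)}\,U\subseteq\mathfrak{T}_{I(0)}$, and the four operators \[ U^*T_1U-e^{\frac{2\pi i}{k}}T_1,\qquad U^*T_1^*U-e^{-\frac{2\pi i}{k}}T_1^*,\qquad U^*T_2U-e^{-\frac{2\pi iF}{k(1-F)}}T_2,\qquad U^*T_2^*U-e^{\frac{2\pi iF}{k(1-F)}}T_2^* \] are compact. -/

import Mathlib

noncomputable section

namespace DruryArveson

/-- `wt m n` is the squared norm of the monomial `z₁ ^ m * z₂ ^ n` in the Drury-Arveson space. -/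
def wt (m n : ℕ) : ℝ := (((m + n).choose m : ℕ) : ℝ)⁻¹

/-- The Drury-Arveson space `H²₂` of the unit ball of `ℂ²`, in coordinates with respect to its
standard orthonormal basis of normalised monomials: `f : H2` stands for the analytic function
`z ↦ ∑ f (m, n) * z₁ ^ m * z₂ ^ n / √(wt m n)`. -/
abbrev H2 : Type := lp (fun _ : ℕ × ℕ => ℂ) 2

/-- The exponent vector of the monomial `z₁ ^ m * z₂ ^ n`. -/
def expo (i : ℕ × ℕ) : Fin 2 →₀ ℕ := Finsupp.single 0 i.1 + Finsupp.single 1 i.2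

lemma expo_apply_zero (i : ℕ × ℕ) : expo i 0 = i.1 := by simp [expo]

lemma expo_apply_one (i : ℕ × ℕ) : expo i 1 = i.2 := by simp [expo]

lemma expo_injective : Function.Injective expo := by
  intro i j h
  have h0 := DFunLike.congr_fun h 0
  have h1 := DFunLike.congr_fun h 1
  rw [expo_apply_zero, expo_apply_zero] at h0
  rw [expo_apply_one, expo_apply_one] at h1
  exact Prod.ext h0 h1

lemma memℓp_polynomial (p : MvPolynomial (Fin 2) ℂ) :
    Memℓp (fun i : ℕ × ℕ => ((√(wt i.1 i.2) : ℝ) : ℂ) * p.coeff (expo i)) 2 := by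
  apply memℓp_gen
  apply summable_of_hasFiniteSupport
  refine Set.Finite.subset (p.support.finite_toSet.preimage expo_injective.injOn) ?_
  intro i hi
  simp only [Function.mem_support] at hi
  simp only [Set.mem_preimage, Finset.mem_coe, MvPolynomial.mem_support_iff]
  intro h
  exact hi (by simp [h])

/-- The inclusion `ℂ[z₁, z₂] → H²₂`. -/
def ofPoly : MvPolynomial (Fin 2) ℂ →ₗ[ℂ] H2 where
  toFun p := ⟨fun i => ((√(wt i.1 i.2) : ℝ) : ℂ) * p.coeff (expo i), memℓp_polynomial p⟩
  map_add' p q := by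
    ext i
    simp only [MvPolynomial.coeff_add, mul_add, lp.coeFn_add, Pi.add_apply]
  map_smul' c p := by
    ext i
    simp [mul_left_comm]

lemma ofPoly_apply (p : MvPolynomial (Fin 2) ℂ) (i : ℕ × ℕ) :
    ofPoly p i = ((√(wt i.1 i.2) : ℝ) : ℂ) * p.coeff (expo i) := rfl

lemma hasSum_extend {σ : ℕ × ℕ → ℕ × ℕ} (hσ : Function.Injective σ) {w : ℕ × ℕ → ℝ}
    (hw : ∀ i, |w i| ≤ 1) (f : H2) :
    (Summable fun j => ‖Function.extend σ (fun i => (w i : ℂ) * f i) 0 j‖ ^ (2 : ENNReal).toReal) ∧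
    ∑' j, ‖Function.extend σ (fun i => (w i : ℂ) * f i) 0 j‖ ^ (2 : ENNReal).toReal
      ≤ ‖f‖ ^ (2 : ENNReal).toReal := by
  have h2 : (0 : ℝ) < (2 : ENNReal).toReal := by norm_num
  have hle : ∀ i, ‖(w i : ℂ) * f i‖ ^ (2 : ENNReal).toReal ≤ ‖f i‖ ^ (2 : ENNReal).toReal := by
    intro i
    refine Real.rpow_le_rpow (norm_nonneg _) ?_ h2.le
    rw [norm_mul, Complex.norm_real, Real.norm_eq_abs]
    exact mul_le_of_le_one_left (norm_nonneg _) (hw i)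
  have hf := (lp.memℓp f).summable h2
  have hs : Summable fun i => ‖(w i : ℂ) * f i‖ ^ (2 : ENNReal).toReal :=
    Summable.of_nonneg_of_le (fun i => Real.rpow_nonneg (norm_nonneg _) _) hle hf
  have hH := (hasSum_extend_zero hσ).2 hs.hasSum
  have heq : (Function.extend σ (fun i => ‖(w i : ℂ) * f i‖ ^ (2 : ENNReal).toReal) 0)
      = fun j => ‖Function.extend σ (fun i => (w i : ℂ) * f i) 0 j‖ ^ (2 : ENNReal).toReal := by
    funext j
    by_cases hj : ∃ i, σ i = j
    · obtain ⟨i, rfl⟩ := hj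
      rw [hσ.extend_apply, hσ.extend_apply]
    · rw [Function.extend_apply' _ _ _ hj, Function.extend_apply' _ _ _ hj]
      simp
  rw [heq] at hH
  refine ⟨hH.summable, ?_⟩
  rw [hH.tsum_eq, lp.norm_rpow_eq_tsum h2]
  exact hs.tsum_le_tsum hle hf

/-- The weighted shift of `H²₂` that sends the basis vector `e i` to `w i • e (σ i)`. -/
def weightedShift (σ : ℕ × ℕ → ℕ × ℕ) (hσ : Function.Injective σ) (w : ℕ × ℕ → ℝ)
    (hw : ∀ i, |w i| ≤ 1) : H2 →L[ℂ] H2 :=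
  LinearMap.mkContinuous
    { toFun := fun f =>
        ⟨Function.extend σ (fun i => (w i : ℂ) * f i) 0, memℓp_gen (hasSum_extend hσ hw f).1⟩
      map_add' := by
        intro f g
        ext j
        by_cases hj : ∃ i, σ i = j
        · obtain ⟨i, rfl⟩ := hj
          simp only [lp.coeFn_add, Pi.add_apply, hσ.extend_apply, mul_add]
        · simp only [lp.coeFn_add, Pi.add_apply, Function.extend_apply' _ _ _ hj, Pi.zero_apply,
            add_zero]
      map_smul' := by
        intro c f
        ext j
        by_cases hj : ∃ i, σ i = j
        · obtain ⟨i, rfl⟩ := hj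
          simp [hσ.extend_apply, mul_left_comm]
        · simp [Function.extend_apply' _ _ _ hj] }
    1
    (by
      intro f
      rw [one_mul]
      have h2 : (0 : ℝ) < (2 : ENNReal).toReal := by norm_num
      refine (Real.rpow_le_rpow_iff (norm_nonneg _) (norm_nonneg _) h2).1 ?_
      rw [lp.norm_rpow_eq_tsum h2]
      exact (hasSum_extend hσ hw f).2)

lemma weightedShift_apply {σ : ℕ × ℕ → ℕ × ℕ} (hσ : Function.Injective σ) {w : ℕ × ℕ → ℝ}
    (hw : ∀ i, |w i| ≤ 1) (f : H2) (i : ℕ × ℕ) :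
    weightedShift σ hσ w hw f (σ i) = (w i : ℂ) * f i :=
  hσ.extend_apply (fun i => (w i : ℂ) * f i) 0 i

lemma weightedShift_apply_of_notMem {σ : ℕ × ℕ → ℕ × ℕ} (hσ : Function.Injective σ)
    {w : ℕ × ℕ → ℝ} (hw : ∀ i, |w i| ≤ 1) (f : H2) {j : ℕ × ℕ} (hj : ¬ ∃ i, σ i = j) :
    weightedShift σ hσ w hw f j = 0 :=
  Function.extend_apply' (fun i => (w i : ℂ) * f i) (0 : ℕ × ℕ → ℂ) j hj

lemma wt_pos (m n : ℕ) : 0 < wt m n :=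
  inv_pos.2 (by exact_mod_cast Nat.choose_pos (Nat.le_add_right m n))

lemma wt_symm (m n : ℕ) : wt m n = wt n m := by
  rw [wt, wt, Nat.choose_symm_add, Nat.add_comm]

lemma wt_succ_right_le (m n : ℕ) : wt m (n + 1) ≤ wt m n := by
  refine inv_anti₀ (by exact_mod_cast Nat.choose_pos (Nat.le_add_right m n)) ?_
  exact_mod_cast Nat.choose_le_choose m (by omega)

lemma wt_succ_left_le (m n : ℕ) : wt (m + 1) n ≤ wt m n := by
  rw [wt_symm (m + 1), wt_symm m]
  exact wt_succ_right_le n m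

lemma abs_sqrt_div_le {a b : ℝ} (hb : 0 < b) (hab : a ≤ b) : |√(a / b)| ≤ 1 := by
  rw [abs_of_nonneg (Real.sqrt_nonneg _)]
  exact Real.sqrt_le_one.2 ((div_le_one hb).2 hab)

/-- Multiplication by the coordinate function `z₁` on `H²₂`. -/
def mulZ₁ : H2 →L[ℂ] H2 :=
  weightedShift (fun i => (i.1 + 1, i.2))
    (fun i j h => by
      simp only [Prod.mk.injEq, add_left_inj] at h
      exact Prod.ext h.1 h.2)
    (fun i => √(wt (i.1 + 1) i.2 / wt i.1 i.2))
    (fun i => abs_sqrt_div_le (wt_pos i.1 i.2) (wt_succ_left_le i.1 i.2))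

/-- Multiplication by the coordinate function `z₂` on `H²₂`. -/
def mulZ₂ : H2 →L[ℂ] H2 :=
  weightedShift (fun i => (i.1, i.2 + 1))
    (fun i j h => by
      simp only [Prod.mk.injEq, add_left_inj] at h
      exact Prod.ext h.1 h.2)
    (fun i => √(wt i.1 (i.2 + 1) / wt i.1 i.2))
    (fun i => abs_sqrt_div_le (wt_pos i.1 i.2) (wt_succ_right_le i.1 i.2))

lemma sqrt_div_mul_sqrt {a b : ℝ} (ha : 0 < a) (hb : 0 < b) (c : ℂ) :
    ((√(a / b) : ℝ) : ℂ) * (((√b : ℝ) : ℂ) * c) = ((√a : ℝ) : ℂ) * c := by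
  rw [← mul_assoc, ← Complex.ofReal_mul, ← Real.sqrt_mul (div_pos ha hb).le,
    div_mul_cancel₀ _ hb.ne']

/-- On polynomials, `mulZ₁` is multiplication by `z₁`. -/
lemma mulZ₁_ofPoly (p : MvPolynomial (Fin 2) ℂ) :
    mulZ₁ (ofPoly p) = ofPoly (MvPolynomial.X 0 * p) := by
  ext j
  obtain ⟨m, n⟩ := j
  cases m with
  | zero =>
    rw [mulZ₁]
    refine (weightedShift_apply_of_notMem _ _ _ (by simp)).trans ?_
    rw [ofPoly_apply,
      MvPolynomial.coeff_X_mul', if_neg (by simp [expo_apply_zero]), mul_zero]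
  | succ m =>
    have h : expo (m + 1, n) = Finsupp.single 0 1 + expo (m, n) := by
      simp only [expo, ← add_assoc, ← Finsupp.single_add, add_comm 1 m]
    rw [mulZ₁]
    refine (weightedShift_apply _ _ _ (m, n)).trans ?_
    rw [ofPoly_apply, ofPoly_apply, h, MvPolynomial.coeff_X_mul]
    exact sqrt_div_mul_sqrt (wt_pos _ _) (wt_pos _ _) _

/-- On polynomials, `mulZ₂` is multiplication by `z₂`. -/
lemma mulZ₂_ofPoly (p : MvPolynomial (Fin 2) ℂ) :
    mulZ₂ (ofPoly p) = ofPoly (MvPolynomial.X 1 * p) := by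
  ext j
  obtain ⟨m, n⟩ := j
  cases n with
  | zero =>
    rw [mulZ₂]
    refine (weightedShift_apply_of_notMem _ _ _ (by simp)).trans ?_
    rw [ofPoly_apply,
      MvPolynomial.coeff_X_mul', if_neg (by simp [expo_apply_one]), mul_zero]
  | succ n =>
    have h : expo (m, n + 1) = Finsupp.single 1 1 + expo (m, n) := by
      simp only [expo, add_left_comm, ← Finsupp.single_add, add_comm 1 n]
    rw [mulZ₂]
    refine (weightedShift_apply _ _ _ (m, n)).trans ?_
    rw [ofPoly_apply, ofPoly_apply, h, MvPolynomial.coeff_X_mul]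
    exact sqrt_div_mul_sqrt (wt_pos _ _) (wt_pos _ _) _

/-- The orthogonal complement `I^⊥` in `H²₂` of an ideal `I` of `ℂ[z₁, z₂]`. -/
abbrev idealPerp (I : Ideal (MvPolynomial (Fin 2) ℂ)) : Submodule ℂ H2 :=
  ((I.restrictScalars ℂ).map ofPoly)ᗮ

/-- The compression `P M |_S` of an operator `M` on `H²₂` to a closed subspace `S`. -/
def compression (S : Submodule ℂ H2) [S.HasOrthogonalProjection] (M : H2 →L[ℂ] H2) :
    S →L[ℂ] S :=
  S.orthogonalProjectionOnto ∘L M ∘L S.subtypeL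

/-- The Toeplitz operator `T₁`, the compression of multiplication by `z₁` to `I^⊥`. -/
def T₁ (I : Ideal (MvPolynomial (Fin 2) ℂ)) : idealPerp I →L[ℂ] idealPerp I :=
  compression (idealPerp I) mulZ₁

/-- The Toeplitz operator `T₂`, the compression of multiplication by `z₂` to `I^⊥`. -/
def T₂ (I : Ideal (MvPolynomial (Fin 2) ℂ)) : idealPerp I →L[ℂ] idealPerp I :=
  compression (idealPerp I) mulZ₂

/-- The C*-subalgebra of the bounded operators on a Hilbert space that is generated by the identity,
the operators in `s` and the compact operators. -/
def cstarGenerated (E : Type*) [NormedAddCommGroup E] [InnerProductSpace ℂ E] [CompleteSpace E]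
    (s : Set (E →L[ℂ] E)) : StarSubalgebra ℂ (E →L[ℂ] E) :=
  (StarAlgebra.adjoin ℂ (s ∪ {K : E →L[ℂ] E | IsCompactOperator K})).topologicalClosure

/-- The Toeplitz algebra of `I`: the C*-algebra of operators on `I^⊥` generated by `1`, `T₁`, `T₂`
and the compact operators. -/
def toeplitzAlgebra (I : Ideal (MvPolynomial (Fin 2) ℂ)) :
    StarSubalgebra ℂ (idealPerp I →L[ℂ] idealPerp I) :=
  cstarGenerated (idealPerp I) {T₁ I, T₂ I}

/-- The ideal `I(t) = ⟨z₁ ^ k - ε e^{it}⟩`. -/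
def perturbedIdeal (k : ℕ) (ε t : ℝ) : Ideal (MvPolynomial (Fin 2) ℂ) :=
  Ideal.span {MvPolynomial.X 0 ^ k - MvPolynomial.C ((ε : ℂ) * Complex.exp (Complex.I * t))}

/-- `ξ` is a flat section of the bundle with fibres `I(t)^⊥`: a smooth map from `ℝ` to `H²₂` with
`ξ t ∈ I(t)^⊥` and `P_t (dξ/dt) = 0` for all `t`. -/
structure IsFlatSection (k : ℕ) (ε : ℝ) (ξ : ℝ → H2) : Prop where
  smooth : ContDiff ℝ ((⊤ : ℕ∞) : WithTop ℕ∞) ξ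
  mem_fibre : ∀ t, ξ t ∈ idealPerp (perturbedIdeal k ε t)
  covariantDeriv_eq_zero :
    ∀ t, (idealPerp (perturbedIdeal k ε t)).orthogonalProjectionOnto (deriv ξ t) = 0

/-- `U` is the parallel transport `U_{2π}` on `I(0)^⊥`: a bounded operator which sends the initial
value `ξ 0` of every flat section `ξ` to its value `ξ (2π)`. -/
def IsMonodromy (k : ℕ) (ε : ℝ)
    (U : idealPerp (perturbedIdeal k ε 0) →L[ℂ] idealPerp (perturbedIdeal k ε 0)) : Prop :=
  ∀ (ξ : ℝ → H2) (hξ : IsFlatSection k ε ξ), (U ⟨ξ 0, hξ.mem_fibre 0⟩ : H2) = ξ (2 * Real.pi)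

end DruryArveson

end

/-!
The fibre `I(t)^⊥` consists of the vectors whose coefficients, rescaled by the norms of the
monomials, satisfy `g (m + k, n) = ε e^{-it} g (m, n)` (`mem_idealPerp_iff`). It therefore has an
orthogonal frame indexed by the classes `(l, n)` with `l < k`, the frame vector of `(l, n)` being
supported on the indices `(m, n)` with `m ≡ l` modulo `k` (`frame`). Distinct frame vectors have
disjoint supports for all times, so the connection is diagonal in the frame, with coefficient
`i * μ(l, n)`, where `μ(l, n)` is the mean of `m / k` over `m ≡ l` with the weights
`F ^ m * (m + n).choose n` (`classMean`, `inner_deriv_frame`). Parallel transport along the loop is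
consequently the diagonal unitary with eigenvalues `exp (2πi μ(l, n))` (`isMonodromy_transport`),
and it is the only monodromy operator because the frame is complete (`IsMonodromy.eq_transport`).

The adjoints of `T₁` and `T₂` are backward weighted shifts in the coordinates, so conjugating them
by the transport multiplies them by a diagonal unitary whose eigenvalues are
`exp (2πi (μ(l + 1, n) - μ(l, n)))` and `exp (2πi (μ(l, n + 1) - μ(l, n)))`. Isolating a residue
class in the binomial series with a roots-of-unity filter gives
`k * μ(l, n) + l = (n + 1) * F / (1 - F) + o(1)` (`tendsto_classMean`), so these eigenvalues converge
to the constants of the theorem as `n → ∞`. A diagonal operator on the fibre whose eigenvalues tend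
to `0` along each of the `k` classes is a norm limit of finite-rank operators, hence compact
(`isCompactOperator_fibreDiag`). The statements on `T₁` and `T₂` follow by taking adjoints, and the
invariance of the Toeplitz algebra follows since its generators are mapped into it
(`conj_mem_cstarGenerated`).
-/

noncomputable section

namespace DruryArveson

/-! ### Power series restricted to a residue class -/

/-- The subseries of `∑ F ^ m * (m + n).choose n = (1 - F) ^ (-(n + 1))` over the exponents `m`
congruent to `l` modulo `k`. -/
def classSum (k : ℕ) (F : ℝ) (l n : ℕ) : ℝ :=
  ∑' m : ℕ, if m ≡ l [MOD k] then ((m + n).choose n : ℝ) * F ^ m else 0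

/-- The subseries of `classSum` with every term weighted by the quotient `m / k`. -/
def classMoment (k : ℕ) (F : ℝ) (l n : ℕ) : ℝ :=
  ∑' m : ℕ, if m ≡ l [MOD k] then ((m / k : ℕ) : ℝ) * (((m + n).choose n : ℝ) * F ^ m) else 0

/-- The mean of the quotient `m / k` over the residue class of `l`, each `m` having the weight
`F ^ m * (m + n).choose n`. -/
def classMean (k : ℕ) (F : ℝ) (l n : ℕ) : ℝ := classMoment k F l n / classSum k F l n

lemma classMean_congr {k : ℕ} (F : ℝ) {l l' : ℕ} (h : l ≡ l' [MOD k]) (n : ℕ) :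
    classMean k F l n = classMean k F l' n := by
  have : ∀ m, m ≡ l [MOD k] ↔ m ≡ l' [MOD k] := fun m => ⟨fun h' => h'.trans h,
    fun h' => h'.trans h.symm⟩
  simp only [classMean, classMoment, classSum, this]

lemma summable_choose_mul_pow {F : ℝ} (h0 : 0 < F) (h1 : F < 1) (n : ℕ) :
    Summable fun m : ℕ => ((m + n).choose n : ℝ) * F ^ m :=
  summable_choose_mul_geometric_of_norm_lt_one n (by rwa [Real.norm_eq_abs, abs_of_pos h0])

/-- Since `(m + 1) * (m + 1 + n).choose n = (n + 1) * (m + (n + 1)).choose (n + 1)`, the first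
moment of a class is again a class sum. -/
lemma hasSum_first_moment {k : ℕ} (hk : 0 < k) {F : ℝ} (h0 : 0 < F) (h1 : F < 1) (l n : ℕ) :
    HasSum (fun m : ℕ => if m ≡ l [MOD k] then (m : ℝ) * (((m + n).choose n : ℝ) * F ^ m) else 0)
      ((n + 1) * F * classSum k F (l + k - 1) (n + 1)) := by
  have hs : Summable fun m : ℕ =>
      if m ≡ l + k - 1 [MOD k] then ((m + (n + 1)).choose (n + 1) : ℝ) * F ^ m else 0 := by
    refine (summable_choose_mul_pow h0 h1 (n + 1)).of_nonneg_of_le (fun m => ?_) (fun m => ?_)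
    · split_ifs <;> positivity
    · split_ifs
      · exact le_rfl
      · positivity
  have h := hs.hasSum.mul_left (((n : ℝ) + 1) * F)
  -- The term `m = 0` vanishes, which permits the index shift `m ↦ m + 1`.
  rw [← hasSum_nat_add_iff' 1]
  simp only [Finset.range_one, Finset.sum_singleton, Nat.cast_zero, zero_mul, ite_self, sub_zero]
  refine h.congr_fun ?_
  intro m
  have hiff : m ≡ l + k - 1 [MOD k] ↔ m + 1 ≡ l [MOD k] := by
    have e : l + k - 1 + 1 = l + k := by omega
    rw [← Nat.ModEq.add_iff_right (Nat.ModEq.refl 1), e]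
    have : l + k ≡ l [MOD k] := by simp [Nat.ModEq]
    exact ⟨fun h => h.trans this, fun h => h.trans this.symm⟩
  by_cases hm : m + 1 ≡ l [MOD k]
  · rw [if_pos hm, if_pos (hiff.2 hm)]
    have hc : (m + 1) * (m + 1 + n).choose n = (n + 1) * (m + (n + 1)).choose (n + 1) := by
      have := Nat.choose_succ_right_eq (m + 1 + n) n
      rw [show m + (n + 1) = m + 1 + n by ring, mul_comm (n + 1), this]
      rw [show m + 1 + n - n = m + 1 by omega, mul_comm]
    have hc' : ((m : ℝ) + 1) * ((m + 1 + n).choose n : ℝ)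
        = (n + 1) * ((m + (n + 1)).choose (n + 1) : ℝ) := by exact_mod_cast hc
    push_cast
    rw [pow_succ]
    linear_combination (F ^ m * F) * hc'
  · rw [if_neg hm, if_neg (fun h => hm (hiff.1 h)), mul_zero]

lemma hasSum_classSum (k : ℕ) {F : ℝ} (h0 : 0 < F) (h1 : F < 1) (l n : ℕ) :
    HasSum (fun m : ℕ => if m ≡ l [MOD k] then ((m + n).choose n : ℝ) * F ^ m else 0)
      (classSum k F l n) := by
  refine Summable.hasSum ?_
  refine (summable_choose_mul_pow h0 h1 n).of_nonneg_of_le (fun m => ?_) (fun m => ?_)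
  · split_ifs <;> positivity
  · split_ifs
    · exact le_rfl
    · positivity

lemma hasSum_classMoment {k : ℕ} (hk : 0 < k) {F : ℝ} (h0 : 0 < F) (h1 : F < 1) (l n : ℕ) :
    HasSum (fun m : ℕ => if m ≡ l [MOD k] then
      ((m / k : ℕ) : ℝ) * (((m + n).choose n : ℝ) * F ^ m) else 0) (classMoment k F l n) := by
  refine Summable.hasSum ?_
  refine (hasSum_first_moment hk h0 h1 l n).summable.of_nonneg_of_le (fun m => ?_) (fun m => ?_)
  · split_ifs <;> positivity
  · split_ifs
    · gcongr
      exact Nat.div_le_self m k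
    · exact le_rfl

lemma classSum_pos {k : ℕ} {F : ℝ} (h0 : 0 < F) (h1 : F < 1) (l n : ℕ) :
    0 < classSum k F l n := by
  refine (hasSum_classSum k h0 h1 l n).summable.tsum_pos (fun m => ?_) l ?_
  · split_ifs <;> positivity
  · rw [if_pos (Nat.ModEq.refl l)]
    have : 0 < (l + n).choose n := Nat.choose_pos (by omega)
    positivity

/-- On the class of `l` one has `m = k * (m / k) + l`, so the mean of `m / k` comes from the mean of
`m`, that is, from `hasSum_first_moment`. -/
lemma classMean_formula {k : ℕ} (hk : 0 < k) {F : ℝ} (h0 : 0 < F) (h1 : F < 1) {l : ℕ}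
    (hl : l < k) (n : ℕ) :
    k * classMean k F l n + l
      = (n + 1) * F * classSum k F (l + k - 1) (n + 1) / classSum k F l n := by
  have hS := (classSum_pos (k := k) h0 h1 l n).ne'
  have h := ((hasSum_classMoment hk h0 h1 l n).mul_left (k : ℝ)).add
    ((hasSum_classSum k h0 h1 l n).mul_left (l : ℝ))
  have heq := h.unique (by
    refine (hasSum_first_moment hk h0 h1 l n).congr_fun ?_
    intro m
    by_cases hm : m ≡ l [MOD k]
    · simp only [if_pos hm]
      have e : k * (m / k) + l = m := by
        have := Nat.div_add_mod m k
        rw [hm, Nat.mod_eq_of_lt hl] at this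
        exact this
      have e' : (k : ℝ) * ((m / k : ℕ) : ℝ) + l = m := by exact_mod_cast e
      linear_combination (((m + n).choose n : ℝ) * F ^ m) * e'
    · simp [if_neg hm])
  rw [classMean, eq_div_iff hS, add_mul, mul_assoc, div_mul_cancel₀ _ hS, heq]

lemma sum_rootsOfUnity_filter {k : ℕ} (hk : 0 < k) {ω : ℂ} (hω : IsPrimitiveRoot ω k)
    (l m : ℕ) :
    ∑ s ∈ Finset.range k, ((ω ^ s)⁻¹ ^ l * (ω ^ s) ^ m)
      = if m ≡ l [MOD k] then (k : ℂ) else 0 := by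
  have hω0 : ω ≠ 0 := hω.ne_zero hk.ne'
  have h1 : ∀ s, (ω ^ s)⁻¹ ^ l * (ω ^ s) ^ m = ((ω ^ l)⁻¹ * ω ^ m) ^ s := by
    intro s
    rw [mul_pow, inv_pow, inv_pow, ← pow_mul, ← pow_mul, ← pow_mul, ← pow_mul, mul_comm s l,
      mul_comm s m]
  simp only [h1]
  have hz : (ω ^ l)⁻¹ * ω ^ m = 1 ↔ m ≡ l [MOD k] := by
    have hmod : ∀ j, ω ^ j = ω ^ (j % k) := fun j => by
      conv_lhs => rw [← Nat.div_add_mod j k, pow_add, pow_mul, hω.pow_eq_one, one_pow, one_mul]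
    rw [inv_mul_eq_one₀ (pow_ne_zero _ hω0), eq_comm, hmod m, hmod l]
    exact ⟨fun h => hω.pow_inj (Nat.mod_lt _ hk) (Nat.mod_lt _ hk) h, fun h => by rw [h]⟩
  by_cases h : m ≡ l [MOD k]
  · simp [if_pos h, hz.2 h]
  · rw [if_neg h, geom_sum_eq (fun h' => h (hz.1 h'))]
    have : ((ω ^ l)⁻¹ * ω ^ m) ^ k = 1 := by
      rw [mul_pow, inv_pow, ← pow_mul, ← pow_mul, mul_comm l, mul_comm m, pow_mul, pow_mul,
        hω.pow_eq_one]
      simp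
    rw [this, sub_self, zero_div]

/-- The roots-of-unity filter for the series `∑ F ^ m * (m + n).choose n`. -/
lemma classSum_eq_sum {k : ℕ} (hk : 0 < k) {ω : ℂ} (hω : IsPrimitiveRoot ω k) {F : ℝ}
    (h0 : 0 < F) (h1 : F < 1) (l n : ℕ) :
    (k : ℂ) * (classSum k F l n : ℝ)
      = ∑ s ∈ Finset.range k, (ω ^ s)⁻¹ ^ l * (1 / (1 - ω ^ s * F) ^ (n + 1)) := by
  have hn : ∀ s, ‖ω ^ s * (F : ℂ)‖ < 1 := by
    intro s
    rw [norm_mul, norm_pow, hω.norm'_eq_one hk.ne', one_pow, one_mul, Complex.norm_real,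
      Real.norm_eq_abs, abs_of_pos h0]
    exact h1
  have hR := hasSum_sum (s := Finset.range k) fun s _ =>
    (hasSum_choose_mul_geometric_of_norm_lt_one n (hn s)).mul_left ((ω ^ s)⁻¹ ^ l)
  have hL := (Complex.hasSum_ofReal.2 (hasSum_classSum k h0 h1 l n)).mul_left (k : ℂ)
  refine hL.unique (hR.congr_fun ?_)
  intro m
  have := sum_rootsOfUnity_filter hk hω l m
  simp only [mul_pow]
  have e : ∀ s, (ω ^ s)⁻¹ ^ l * (((m + n).choose n : ℂ) * ((ω ^ s) ^ m * (F : ℂ) ^ m))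
      = (ω ^ s)⁻¹ ^ l * (ω ^ s) ^ m * (((m + n).choose n : ℂ) * (F : ℂ) ^ m) := fun s => by ring
  simp only [e, ← Finset.sum_mul, this]
  split_ifs <;> simp

lemma norm_div_one_sub_lt_one {F : ℝ} (h0 : 0 < F) (h1 : F < 1) {z : ℂ} (hz : ‖z‖ = 1)
    (hz1 : z ≠ 1) : ‖(1 - (F : ℂ)) / (1 - z * F)‖ < 1 := by
  have hsq : z.re * z.re + z.im * z.im = 1 := by
    have := Complex.normSq_eq_norm_sq z
    rw [hz, Complex.normSq_apply] at this
    linarith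
  have hre : z.re < 1 := by
    rcases lt_or_ge z.re 1 with h | h
    · exact h
    · exfalso
      have him : z.im = 0 := by nlinarith
      have hre : z.re = 1 := by rw [him] at hsq; nlinarith
      exact hz1 (Complex.ext hre him)
  have hlt : ‖(1 - (F : ℂ))‖ < ‖1 - z * F‖ := by
    rw [← sq_lt_sq₀ (norm_nonneg _) (norm_nonneg _), ← Complex.normSq_eq_norm_sq,
      ← Complex.normSq_eq_norm_sq, Complex.normSq_apply, Complex.normSq_apply]
    simp only [Complex.sub_re, Complex.one_re, Complex.ofReal_re, Complex.sub_im, Complex.one_im,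
      Complex.ofReal_im, Complex.mul_re, Complex.mul_im, mul_zero, sub_zero, zero_add, add_zero]
    nlinarith [mul_pos h0 (sub_pos.2 hre)]
  rw [norm_div]
  exact (div_lt_one (lt_of_le_of_lt (norm_nonneg _) hlt)).2 hlt

/-- The class sums over the different residue classes share the growth of the full series up to an
exponentially small relative error: only the root of unity `1` contributes in the limit. -/
lemma tendsto_classSum {k : ℕ} (hk : 0 < k) {F : ℝ} (h0 : 0 < F) (h1 : F < 1) (l : ℕ) :
    Filter.Tendsto (fun n : ℕ => ((n : ℝ) + 1) * (k * (1 - F) ^ (n + 1) * classSum k F l n - 1))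
      Filter.atTop (nhds 0) := by
  obtain ⟨ω, hω⟩ : ∃ ω : ℂ, IsPrimitiveRoot ω k := ⟨_, Complex.isPrimitiveRoot_exp k hk.ne'⟩
  rw [← Filter.tendsto_ofReal_iff, Complex.ofReal_zero]
  have hF : (1 - (F : ℂ)) ≠ 0 := by
    rw [sub_ne_zero]
    exact_mod_cast h1.ne'
  have heq : ∀ n : ℕ,
      ((((n : ℝ) + 1) * (k * (1 - F) ^ (n + 1) * classSum k F l n - 1) : ℝ) : ℂ)
      = ∑ s ∈ (Finset.range k).erase 0,
        (ω ^ s)⁻¹ ^ l * (((n + 1 : ℕ) : ℂ) * ((1 - (F : ℂ)) / (1 - ω ^ s * F)) ^ (n + 1)) := by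
    intro n
    have h := classSum_eq_sum hk hω h0 h1 l n
    rw [← Finset.add_sum_erase _ _ (Finset.mem_range.2 hk)] at h
    simp only [pow_zero, inv_one, one_pow, one_mul] at h
    have h' : (k : ℂ) * (1 - (F : ℂ)) ^ (n + 1) * (classSum k F l n : ℝ) - 1
        = ∑ s ∈ (Finset.range k).erase 0,
          (ω ^ s)⁻¹ ^ l * ((1 - (F : ℂ)) / (1 - ω ^ s * F)) ^ (n + 1) := by
      rw [mul_right_comm, h, add_mul, one_div_mul_cancel (pow_ne_zero _ hF), add_sub_cancel_left,
        Finset.sum_mul]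
      refine Finset.sum_congr rfl fun s _ => ?_
      rw [div_pow]
      ring
    push_cast
    rw [h', Finset.mul_sum]
    refine Finset.sum_congr rfl fun s _ => ?_
    ring
  simp only [heq]
  have hlim : ∀ s ∈ (Finset.range k).erase 0, Filter.Tendsto (fun n : ℕ =>
      (ω ^ s)⁻¹ ^ l * (((n + 1 : ℕ) : ℂ) * ((1 - (F : ℂ)) / (1 - ω ^ s * F)) ^ (n + 1)))
      Filter.atTop (nhds 0) := by
    intro s hs
    rw [Finset.mem_erase, Finset.mem_range] at hs
    have hr := norm_div_one_sub_lt_one h0 h1 (z := ω ^ s)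
      (by rw [norm_pow, hω.norm'_eq_one hk.ne', one_pow])
      (hω.pow_ne_one_of_pos_of_lt hs.1 hs.2)
    have ht := (tendsto_self_mul_const_pow_of_lt_one (norm_nonneg _) hr).comp
      (Filter.tendsto_add_atTop_nat 1)
    rw [← mul_zero ((ω ^ s)⁻¹ ^ l)]
    refine Filter.Tendsto.const_mul _ ?_
    rw [tendsto_zero_iff_norm_tendsto_zero]
    refine ht.congr fun n => ?_
    simp only [Function.comp_apply, norm_mul, norm_pow, Complex.norm_natCast]
  have := tendsto_finsetSum _ hlim
  simpa using this

/-- The mean over the class of `l` is asymptotic to the mean `(n + 1) * F / (1 - F)` of the full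
series, up to the affine change of variable `m = k * (m / k) + l`. -/
lemma tendsto_classMean {k : ℕ} (hk : 0 < k) {F : ℝ} (h0 : 0 < F) (h1 : F < 1) {l : ℕ}
    (hl : l < k) :
    Filter.Tendsto (fun n : ℕ => k * classMean k F l n + l - (n + 1) * (F / (1 - F)))
      Filter.atTop (nhds 0) := by
  set a : ℕ → ℕ → ℝ := fun l n => k * (1 - F) ^ (n + 1) * classSum k F l n with ha
  have hF : (1 - F) ≠ 0 := by linarith
  have hk' : (k : ℝ) ≠ 0 := by positivity
  have hA := tendsto_classSum hk h0 h1 l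
  have hB := (tendsto_classSum hk h0 h1 (l + k - 1)).comp (Filter.tendsto_add_atTop_nat 1)
  have hinv : Filter.Tendsto (fun n : ℕ => 1 / ((n : ℝ) + 1)) Filter.atTop (nhds 0) :=
    tendsto_one_div_add_atTop_nhds_zero_nat
  have hA1 : Filter.Tendsto (fun n => a l n) Filter.atTop (nhds 1) := by
    have := (hinv.mul hA).add_const 1
    simp only [mul_zero, zero_add] at this
    refine this.congr fun n => ?_
    have : (n : ℝ) + 1 ≠ 0 := by positivity
    simp only [ha]
    field_simp
    ring
  have hB' : Filter.Tendsto (fun n : ℕ => ((n : ℝ) + 1) * (a (l + k - 1) (n + 1) - 1))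
      Filter.atTop (nhds 0) := by
    have h2 : Filter.Tendsto (fun n : ℕ => ((n : ℝ) + 1) / ((n : ℝ) + 2)) Filter.atTop (nhds 1) := by
      have := (hinv.comp (Filter.tendsto_add_atTop_nat 1)).const_sub 1
      rw [sub_zero] at this
      refine this.congr fun n => ?_
      simp only [Function.comp_apply]
      push_cast
      have : (n : ℝ) + 2 ≠ 0 := by positivity
      have : (n : ℝ) + 1 + 1 ≠ 0 := by positivity
      field_simp
      ring
    have h3 := h2.mul hB
    rw [mul_zero] at h3
    refine h3.congr fun n => ?_
    simp only [Function.comp_apply, ha]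
    push_cast
    have : (n : ℝ) + 2 ≠ 0 := by positivity
    field_simp
    ring
  -- `classMean_formula` writes the difference as
  -- `F / (1 - F) * ((n + 1) * (a (l - 1) (n + 1) - a l n)) / a l n`.
  have hlim := ((hB'.sub hA).const_mul (F / (1 - F))).div hA1 one_ne_zero
  rw [sub_zero, mul_zero, zero_div] at hlim
  refine hlim.congr fun n => ?_
  have hS := (classSum_pos (k := k) h0 h1 l n).ne'
  rw [classMean_formula hk h0 h1 hl]
  simp only [ha, Pi.div_apply]
  have : (1 - F) ^ (n + 1) ≠ 0 := pow_ne_zero _ hF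
  rw [pow_succ _ (n + 1)]
  field_simp
  ring

/-! ### Coordinates of the fibres -/

/-- The number `ε e^{it}`; the ideal `I(t)` is generated by `z₁ ^ k` minus this constant. -/
def rootParam (ε t : ℝ) : ℂ := (ε : ℂ) * Complex.exp (Complex.I * t)

lemma sqrt_wt_ne_zero (m n : ℕ) : ((√(wt m n) : ℝ) : ℂ) ≠ 0 :=
  Complex.ofReal_ne_zero.2 (Real.sqrt_pos.2 (wt_pos m n)).ne'

lemma exists_expo (u : Fin 2 →₀ ℕ) : ∃ m n, expo (m, n) = u := by
  refine ⟨u 0, u 1, ?_⟩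
  ext i
  fin_cases i
  · exact expo_apply_zero _
  · exact expo_apply_one _

lemma ofPoly_monomial (i : ℕ × ℕ) (a : ℂ) :
    ofPoly (MvPolynomial.monomial (expo i) a)
      = lp.single 2 i (((√(wt i.1 i.2) : ℝ) : ℂ) * a) := by
  ext j
  rw [ofPoly_apply, MvPolynomial.coeff_monomial]
  by_cases h : j = i
  · subst h
    rw [if_pos rfl, lp.single_apply_self]
  · rw [if_neg (fun h' => h (expo_injective h').symm), lp.single_apply_ne _ _ _ h, mul_zero]

lemma inner_ofPoly_monomial (i : ℕ × ℕ) (a : ℂ) (v : H2) :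
    inner ℂ (ofPoly (MvPolynomial.monomial (expo i) a)) v
      = star a * (((√(wt i.1 i.2) : ℝ) : ℂ) * v i) := by
  rw [ofPoly_monomial, lp.inner_single_left]
  rw [RCLike.inner_apply, map_mul, Complex.conj_ofReal, starRingEnd_apply]
  ring

lemma monomial_mul_generator (k m n : ℕ) (a c : ℂ) :
    MvPolynomial.monomial (expo (m, n)) a * (MvPolynomial.X 0 ^ k - MvPolynomial.C c)
      = MvPolynomial.monomial (expo (m + k, n)) a
        - MvPolynomial.monomial (expo (m, n)) (a * c) := by
  have : expo (m + k, n) = expo (m, n) + Finsupp.single 0 k := by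
    simp only [expo, Finsupp.single_add]
    abel
  rw [mul_sub, MvPolynomial.X_pow_eq_monomial, MvPolynomial.monomial_mul, mul_one, this,
    mul_comm _ (MvPolynomial.C c), MvPolynomial.C_mul_monomial, mul_comm c]

/-- A vector is orthogonal to `I(t)` exactly if its coefficients, rescaled by the norms of the
monomials, satisfy a one-step recursion along each residue class modulo `k`. -/
lemma mem_idealPerp_iff {k : ℕ} {ε t : ℝ} {v : H2} :
    v ∈ idealPerp (perturbedIdeal k ε t) ↔ ∀ m n,
      ((√(wt (m + k) n) : ℝ) : ℂ) * v (m + k, n)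
        = star (rootParam ε t) * (((√(wt m n) : ℝ) : ℂ) * v (m, n)) := by
  have key : ∀ m n a, inner ℂ (ofPoly (MvPolynomial.monomial (expo (m, n)) a *
      (MvPolynomial.X 0 ^ k - MvPolynomial.C (rootParam ε t)))) v
      = star a * (((√(wt (m + k) n) : ℝ) : ℂ) * v (m + k, n)
        - star (rootParam ε t) * (((√(wt m n) : ℝ) : ℂ) * v (m, n))) := by
    intro m n a
    rw [monomial_mul_generator, map_sub, inner_sub_left, inner_ofPoly_monomial,
      inner_ofPoly_monomial, star_mul']
    ring
  rw [Submodule.mem_orthogonal]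
  constructor
  · intro h m n
    have h1 := h (ofPoly (MvPolynomial.monomial (expo (m, n)) 1 *
      (MvPolynomial.X 0 ^ k - MvPolynomial.C (rootParam ε t))))
      (Submodule.mem_map_of_mem (Ideal.mul_mem_left _ _ (Ideal.subset_span rfl)))
    rw [key, star_one, one_mul, sub_eq_zero] at h1
    exact h1
  · rintro h _ ⟨p, hp, rfl⟩
    obtain ⟨q, rfl⟩ := Ideal.mem_span_singleton'.1 hp
    change inner ℂ (ofPoly (q * (MvPolynomial.X 0 ^ k - MvPolynomial.C (rootParam ε t)))) v = 0
    induction q using MvPolynomial.induction_on' with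
    | monomial u a =>
      obtain ⟨m, n, rfl⟩ := exists_expo u
      rw [key, h, sub_self, mul_zero]
    | add p q ihp ihq =>
      rw [add_mul, map_add, inner_add_left,
        ihp (Ideal.mul_mem_left _ _ (Ideal.subset_span rfl)),
        ihq (Ideal.mul_mem_left _ _ (Ideal.subset_span rfl)), add_zero]

/-- The value at an index of a vector of the fibre, in terms of the value at the least index of the
same residue class. -/
lemma coeff_of_mem_idealPerp {k : ℕ} {ε t : ℝ} {v : H2}
    (hv : v ∈ idealPerp (perturbedIdeal k ε t)) (m n : ℕ) :
    ((√(wt m n) : ℝ) : ℂ) * v (m, n)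
      = star (rootParam ε t) ^ (m / k) * (((√(wt (m % k) n) : ℝ) : ℂ) * v (m % k, n)) := by
  have h : ∀ l j : ℕ, ((√(wt (l + k * j) n) : ℝ) : ℂ) * v (l + k * j, n)
      = star (rootParam ε t) ^ j * (((√(wt l n) : ℝ) : ℂ) * v (l, n)) := by
    intro l j
    induction j with
    | zero => simp
    | succ j ih =>
      have := mem_idealPerp_iff.1 hv (l + k * j) n
      rw [ih] at this
      rw [Nat.mul_succ, ← add_assoc, this, pow_succ]
      ring
  have := h (m % k) (m / k)
  rwa [Nat.mod_add_div] at this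

/-! ### Diagonal operators -/

lemma summable_mul_of_bounded {d : ℕ × ℕ → ℂ} {C : ℝ} (hd : ∀ i, ‖d i‖ ≤ C) (f : H2) :
    (Summable fun i => ‖d i * f i‖ ^ (2 : ENNReal).toReal) ∧
    ∑' i, ‖d i * f i‖ ^ (2 : ENNReal).toReal ≤ (C * ‖f‖) ^ (2 : ENNReal).toReal := by
  have h2 : (0 : ℝ) < (2 : ENNReal).toReal := by norm_num
  have hC : 0 ≤ C := (norm_nonneg _).trans (hd (0, 0))
  have hle : ∀ i, ‖d i * f i‖ ^ (2 : ENNReal).toReal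
      ≤ C ^ (2 : ENNReal).toReal * ‖f i‖ ^ (2 : ENNReal).toReal := by
    intro i
    rw [← Real.mul_rpow hC (norm_nonneg _), norm_mul]
    exact Real.rpow_le_rpow (by positivity)
      (mul_le_mul_of_nonneg_right (hd i) (norm_nonneg _)) h2.le
  have hf := ((lp.memℓp f).summable h2).mul_left (C ^ (2 : ENNReal).toReal)
  have hs : Summable fun i => ‖d i * f i‖ ^ (2 : ENNReal).toReal :=
    hf.of_nonneg_of_le (fun i => Real.rpow_nonneg (norm_nonneg _) _) hle
  refine ⟨hs, ?_⟩
  rw [Real.mul_rpow hC (norm_nonneg _), lp.norm_rpow_eq_tsum h2, ← tsum_mul_left]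
  exact hs.tsum_le_tsum hle hf

lemma exists_mul_memℓp {d : ℕ × ℕ → ℂ} (hd : ∃ C, ∀ i, ‖d i‖ ≤ C) (f : H2) :
    Memℓp (fun i => d i * f i) 2 :=
  memℓp_gen (summable_mul_of_bounded hd.choose_spec f).1

/-- The operator on `H²₂` that is diagonal with respect to the monomials, with the bounded family
`d` of eigenvalues. -/
def diagOp (d : ℕ × ℕ → ℂ) (hd : ∃ C, ∀ i, ‖d i‖ ≤ C) : H2 →L[ℂ] H2 :=
  LinearMap.mkContinuousOfExistsBound
    { toFun := fun f => ⟨fun i => d i * f i, exists_mul_memℓp hd f⟩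
      map_add' := by
        intro f g
        ext i
        simp only [lp.coeFn_add, Pi.add_apply, mul_add]
      map_smul' := by
        intro c f
        ext i
        simp [mul_left_comm] }
    (by
      obtain ⟨C, hC⟩ := hd
      refine ⟨C, fun f => ?_⟩
      have h2 : (0 : ℝ) < (2 : ENNReal).toReal := by norm_num
      have hC0 : 0 ≤ C := (norm_nonneg _).trans (hC (0, 0))
      refine (Real.rpow_le_rpow_iff (norm_nonneg _) (by positivity) h2).1 ?_
      rw [lp.norm_rpow_eq_tsum h2]
      exact (summable_mul_of_bounded hC f).2)

lemma diagOp_apply {d : ℕ × ℕ → ℂ} (hd : ∃ C, ∀ i, ‖d i‖ ≤ C) (f : H2) (i : ℕ × ℕ) :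
    diagOp d hd f i = d i * f i := rfl

lemma norm_diagOp_apply_le {d : ℕ × ℕ → ℂ} (hd : ∃ C, ∀ i, ‖d i‖ ≤ C) {C : ℝ}
    (hC : ∀ i, ‖d i‖ ≤ C) (f : H2) : ‖diagOp d hd f‖ ≤ C * ‖f‖ := by
  have h2 : (0 : ℝ) < (2 : ENNReal).toReal := by norm_num
  have hC0 : 0 ≤ C := (norm_nonneg _).trans (hC (0, 0))
  refine (Real.rpow_le_rpow_iff (norm_nonneg _) (by positivity) h2).1 ?_
  rw [lp.norm_rpow_eq_tsum h2]
  exact (summable_mul_of_bounded hC f).2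

/-- A bounded family of eigenvalues that only depends on the first index modulo `k`. -/
structure IsClassMultiplier (k : ℕ) (d : ℕ × ℕ → ℂ) : Prop where
  bounded : ∃ C, ∀ i, ‖d i‖ ≤ C
  periodic : ∀ m n, d (m + k, n) = d (m, n)

lemma IsClassMultiplier.conj {k : ℕ} {d : ℕ × ℕ → ℂ} (hd : IsClassMultiplier k d) :
    IsClassMultiplier k fun i => star (d i) where
  bounded := by
    obtain ⟨C, hC⟩ := hd.bounded
    exact ⟨C, fun i => by rw [norm_star]; exact hC i⟩
  periodic m n := by rw [hd.periodic]

lemma diagOp_mem {k : ℕ} {ε t : ℝ} {d : ℕ × ℕ → ℂ} (hd : IsClassMultiplier k d) {v : H2}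
    (hv : v ∈ idealPerp (perturbedIdeal k ε t)) :
    diagOp d hd.bounded v ∈ idealPerp (perturbedIdeal k ε t) := by
  rw [mem_idealPerp_iff] at hv ⊢
  intro m n
  rw [diagOp_apply, diagOp_apply, hd.periodic, mul_left_comm, hv]
  ring

/-- The restriction of a diagonal operator to the fibre `I(t)^⊥`, which it leaves invariant. -/
def fibreDiag (k : ℕ) (ε t : ℝ) (d : ℕ × ℕ → ℂ) (hd : IsClassMultiplier k d) :
    idealPerp (perturbedIdeal k ε t) →L[ℂ] idealPerp (perturbedIdeal k ε t) :=
  (diagOp d hd.bounded ∘L (idealPerp (perturbedIdeal k ε t)).subtypeL).codRestrict _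
    fun v => diagOp_mem hd v.2

lemma fibreDiag_apply {k : ℕ} {ε t : ℝ} {d : ℕ × ℕ → ℂ} (hd : IsClassMultiplier k d)
    (v : idealPerp (perturbedIdeal k ε t)) (i : ℕ × ℕ) :
    (fibreDiag k ε t d hd v : H2) i = d i * (v : H2) i := rfl

lemma star_fibreDiag {k : ℕ} {ε t : ℝ} {d : ℕ × ℕ → ℂ} (hd : IsClassMultiplier k d) :
    star (fibreDiag k ε t d hd) = fibreDiag k ε t (fun i => star (d i)) hd.conj := by
  rw [ContinuousLinearMap.star_eq_adjoint, eq_comm, ContinuousLinearMap.eq_adjoint_iff]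
  intro v w
  rw [Submodule.coe_inner, Submodule.coe_inner, lp.inner_eq_tsum, lp.inner_eq_tsum]
  refine tsum_congr fun i => ?_
  rw [fibreDiag_apply, fibreDiag_apply]
  simp only [RCLike.inner_apply, map_mul, starRingEnd_apply, star_star]
  ring

/-! ### Compactness of diagonal operators on a fibre -/

/-- Vectors of the fibre whose coefficients vanish in degree `≥ N` in the second variable. -/
def lowDegree (k : ℕ) (ε t : ℝ) (N : ℕ) : Submodule ℂ (idealPerp (perturbedIdeal k ε t)) where
  carrier := {v | ∀ m n, N ≤ n → (v : H2) (m, n) = 0}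
  add_mem' := by
    intro v w hv hw m n hn
    simp [hv m n hn, hw m n hn]
  zero_mem' := by
    intro m n _
    simp
  smul_mem' := by
    intro c v hv m n hn
    simp [hv m n hn]

/-- By the recursion along residue classes, a vector of the fibre is determined by its coefficients
with first index below `k`. -/
lemma finiteDimensional_lowDegree {k : ℕ} (hk : 0 < k) (ε t : ℝ) (N : ℕ) :
    FiniteDimensional ℂ (lowDegree k ε t N) := by
  let φ : lowDegree k ε t N →ₗ[ℂ] (Fin k × Fin N → ℂ) :=
    { toFun := fun v i => ((v : idealPerp (perturbedIdeal k ε t)) : H2) (i.1, i.2)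
      map_add' := fun v w => by ext i; simp
      map_smul' := fun c v => by ext i; simp }
  refine FiniteDimensional.of_injective φ ?_
  rw [← LinearMap.ker_eq_bot, LinearMap.ker_eq_bot']
  intro v hv
  refine Subtype.ext (Subtype.ext ?_)
  ext ⟨m, n⟩
  change ((v : idealPerp (perturbedIdeal k ε t)) : H2) (m, n) = 0
  by_cases hn : N ≤ n
  · exact v.2 m n hn
  · have h0 : ((v : idealPerp (perturbedIdeal k ε t)) : H2) (m % k, n) = 0 :=
      congr_fun hv (⟨m % k, Nat.mod_lt _ hk⟩, ⟨n, not_le.1 hn⟩)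
    have h := coeff_of_mem_idealPerp v.1.2 m n
    rw [h0, mul_zero, mul_zero] at h
    exact (mul_eq_zero.1 h).resolve_left (sqrt_wt_ne_zero m n)

lemma isCompactOperator_of_range_le {E : Type*} [NormedAddCommGroup E] [NormedSpace ℂ E]
    (A : E →L[ℂ] E) (V : Submodule ℂ E) [FiniteDimensional ℂ V] (h : ∀ v, A v ∈ V) :
    IsCompactOperator A := by
  have : ProperSpace V := FiniteDimensional.proper ℂ V
  have h1 : IsCompactOperator (A.codRestrict V h) :=
    isCompactOperator_of_locallyCompactSpace_dom (A.codRestrict V h)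
  exact h1.clm_comp V.subtypeL

/-- A diagonal operator on the fibre is compact once its eigenvalues tend to `0` along each of the
`k` residue classes: it is the norm limit of its truncations, which have finite rank. -/
lemma isCompactOperator_fibreDiag {k : ℕ} (hk : 0 < k) {ε t : ℝ} {d : ℕ × ℕ → ℂ}
    (hd : IsClassMultiplier k d)
    (hlim : ∀ l < k, Filter.Tendsto (fun n => d (l, n)) Filter.atTop (nhds 0)) :
    IsCompactOperator (fibreDiag k ε t d hd) := by
  have hmod : ∀ m n, d (m, n) = d (m % k, n) := by
    intro m n
    have h : ∀ l j : ℕ, d (l + k * j, n) = d (l, n) := by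
      intro l j
      induction j with
      | zero => rfl
      | succ j ih => rw [Nat.mul_succ, ← add_assoc, hd.periodic, ih]
    conv_lhs => rw [← Nat.mod_add_div m k]
    exact h _ _
  have htr : ∀ N, IsClassMultiplier k fun i => if i.2 < N then d i else 0 := by
    intro N
    obtain ⟨C, hC⟩ := hd.bounded
    refine ⟨⟨C, fun i => ?_⟩, fun m n => ?_⟩
    · split_ifs
      · exact hC i
      · rw [norm_zero]
        exact (norm_nonneg _).trans (hC i)
    · simp only [hd.periodic]
  refine isCompactOperator_of_tendsto (l := Filter.atTop)
    (F := fun N => fibreDiag k ε t _ (htr N)) ?_ (Filter.Eventually.of_forall fun N => ?_)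
  · rw [Metric.tendsto_atTop]
    intro δ hδ
    have hev : ∀ᶠ n in Filter.atTop, ∀ l ∈ Finset.range k, ‖d (l, n)‖ ≤ δ / 2 := by
      rw [Filter.eventually_all_finset]
      intro l hl
      have := (hlim l (Finset.mem_range.1 hl)).norm
      rw [norm_zero] at this
      exact this.eventually_le_const (half_pos hδ)
    obtain ⟨N, hN⟩ := Filter.eventually_atTop.1 hev
    refine ⟨N, fun M hM => ?_⟩
    rw [dist_eq_norm, norm_sub_rev]
    refine lt_of_le_of_lt ?_ (half_lt_self hδ)
    refine ContinuousLinearMap.opNorm_le_bound _ (half_pos hδ).le fun v => ?_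
    have hb : ∀ i, ‖d i - (if i.2 < M then d i else 0)‖ ≤ δ / 2 := by
      rintro ⟨m, n⟩
      by_cases h : n < M
      · rw [if_pos h, sub_self, norm_zero]
        exact (half_pos hδ).le
      · rw [if_neg h, sub_zero, hmod]
        exact hN n (hM.trans (not_lt.1 h)) _ (Finset.mem_range.2 (Nat.mod_lt _ hk))
    have heq : (((fibreDiag k ε t d hd - fibreDiag k ε t _ (htr M)) v :
        idealPerp (perturbedIdeal k ε t)) : H2)
        = diagOp (fun i => d i - (if i.2 < M then d i else 0)) ⟨_, hb⟩ v := by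
      ext i
      rw [diagOp_apply, sub_mul]
      rfl
    change ‖(((fibreDiag k ε t d hd - fibreDiag k ε t _ (htr M)) v :
        idealPerp (perturbedIdeal k ε t)) : H2)‖ ≤ _
    rw [heq]
    exact norm_diagOp_apply_le _ hb _
  · have := finiteDimensional_lowDegree hk ε t N
    refine isCompactOperator_of_range_le _ (lowDegree k ε t N) fun v m n hn => ?_
    rw [fibreDiag_apply, if_neg (not_lt.2 hn), zero_mul]

/-! ### Adjoints of the compressed shifts -/

lemma lp_apply_eq_inner (f : H2) (i : ℕ × ℕ) :
    f i = inner ℂ (lp.single 2 i (1 : ℂ) : H2) f := by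
  rw [lp.inner_single_left]
  simp

lemma adjoint_weightedShift_apply {σ : ℕ × ℕ → ℕ × ℕ} (hσ : Function.Injective σ)
    {w : ℕ × ℕ → ℝ} (hw : ∀ i, |w i| ≤ 1) (f : H2) (i : ℕ × ℕ) :
    ContinuousLinearMap.adjoint (weightedShift σ hσ w hw) f i = (w i : ℂ) * f (σ i) := by
  have h : weightedShift σ hσ w hw (lp.single 2 i (1 : ℂ)) = lp.single 2 (σ i) (w i : ℂ) := by
    ext j
    by_cases hj : ∃ i', σ i' = j
    · obtain ⟨i', rfl⟩ := hj
      rw [weightedShift_apply]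
      by_cases hi : i' = i
      · subst hi
        rw [lp.single_apply_self, lp.single_apply_self, mul_one]
      · rw [lp.single_apply_ne _ _ _ hi, lp.single_apply_ne _ _ _ (hσ.ne hi), mul_zero]
    · rw [weightedShift_apply_of_notMem hσ hw _ hj, lp.single_apply_ne]
      rintro rfl
      exact hj ⟨i, rfl⟩
  rw [lp_apply_eq_inner, ContinuousLinearMap.adjoint_inner_right, h, lp.inner_single_left]
  simp [mul_comm]

lemma star_compression_apply (S : Submodule ℂ H2) [CompleteSpace S] [S.HasOrthogonalProjection]
    (M : H2 →L[ℂ] H2) (hM : ∀ v ∈ S, ContinuousLinearMap.adjoint M v ∈ S) (v : S) :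
    ((star (compression S M) v : S) : H2) = ContinuousLinearMap.adjoint M v := by
  have : star (compression S M) v = ⟨ContinuousLinearMap.adjoint M v, hM v v.2⟩ := by
    refine ext_inner_right ℂ fun w => ?_
    rw [ContinuousLinearMap.star_eq_adjoint, ContinuousLinearMap.adjoint_inner_left,
      Submodule.coe_inner _ (⟨_, hM v v.2⟩ : S), ContinuousLinearMap.adjoint_inner_left]
    exact Submodule.inner_orthogonalProjectionOnto_eq_of_mem_left _ _
  rw [this]

lemma adjoint_mulZ₁_apply (f : H2) (m n : ℕ) :
    ContinuousLinearMap.adjoint mulZ₁ f (m, n)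
      = ((√(wt (m + 1) n / wt m n) : ℝ) : ℂ) * f (m + 1, n) :=
  adjoint_weightedShift_apply _ _ f (m, n)

lemma adjoint_mulZ₂_apply (f : H2) (m n : ℕ) :
    ContinuousLinearMap.adjoint mulZ₂ f (m, n)
      = ((√(wt m (n + 1) / wt m n) : ℝ) : ℂ) * f (m, n + 1) :=
  adjoint_weightedShift_apply _ _ f (m, n)

lemma sqrt_mul_sqrt_div {a b : ℝ} (ha : 0 < a) (hb : 0 < b) (c : ℂ) :
    ((√b : ℝ) : ℂ) * (((√(a / b) : ℝ) : ℂ) * c) = ((√a : ℝ) : ℂ) * c := by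
  rw [mul_left_comm, sqrt_div_mul_sqrt ha hb]

lemma adjoint_mulZ₁_mem {k : ℕ} {ε t : ℝ} {v : H2}
    (hv : v ∈ idealPerp (perturbedIdeal k ε t)) :
    ContinuousLinearMap.adjoint mulZ₁ v ∈ idealPerp (perturbedIdeal k ε t) := by
  rw [mem_idealPerp_iff] at hv ⊢
  intro m n
  rw [adjoint_mulZ₁_apply, adjoint_mulZ₁_apply, sqrt_mul_sqrt_div (wt_pos _ _) (wt_pos _ _),
    sqrt_mul_sqrt_div (wt_pos _ _) (wt_pos _ _), add_right_comm]
  exact hv (m + 1) n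

lemma adjoint_mulZ₂_mem {k : ℕ} {ε t : ℝ} {v : H2}
    (hv : v ∈ idealPerp (perturbedIdeal k ε t)) :
    ContinuousLinearMap.adjoint mulZ₂ v ∈ idealPerp (perturbedIdeal k ε t) := by
  rw [mem_idealPerp_iff] at hv ⊢
  intro m n
  rw [adjoint_mulZ₂_apply, adjoint_mulZ₂_apply, sqrt_mul_sqrt_div (wt_pos _ _) (wt_pos _ _),
    sqrt_mul_sqrt_div (wt_pos _ _) (wt_pos _ _)]
  exact hv m (n + 1)

lemma star_T₁_apply {k : ℕ} {ε t : ℝ} (v : idealPerp (perturbedIdeal k ε t)) (m n : ℕ) :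
    (star (T₁ (perturbedIdeal k ε t)) v : H2) (m, n)
      = ((√(wt (m + 1) n / wt m n) : ℝ) : ℂ) * (v : H2) (m + 1, n) := by
  rw [T₁, star_compression_apply (idealPerp (perturbedIdeal k ε t)) mulZ₁
    (fun v hv => adjoint_mulZ₁_mem hv) v, adjoint_mulZ₁_apply]

lemma star_T₂_apply {k : ℕ} {ε t : ℝ} (v : idealPerp (perturbedIdeal k ε t)) (m n : ℕ) :
    (star (T₂ (perturbedIdeal k ε t)) v : H2) (m, n)
      = ((√(wt m (n + 1) / wt m n) : ℝ) : ℂ) * (v : H2) (m, n + 1) := by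
  rw [T₂, star_compression_apply (idealPerp (perturbedIdeal k ε t)) mulZ₂
    (fun v hv => adjoint_mulZ₂_mem hv) v, adjoint_mulZ₂_apply]

/-! ### The orthogonal frame of the fibres -/

/-- The coefficient of `classVector` at `(m, n)`. -/
def classCoeff (k l n : ℕ) (c : ℂ) (m : ℕ) : ℂ :=
  if m ≡ l [MOD k] then c ^ (m / k) * ((√(wt m n) : ℝ) : ℂ)⁻¹ else 0

/-- The vector with coefficients `c ^ (m / k) / √(wt m n)` at the indices `(m, n)` with `m ≡ l`
modulo `k`, and coefficient `0` elsewhere. The series converges for `‖c‖ < 1`. With `c` the conjugate of `ε e^{it}`, these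
vectors are an orthogonal basis of `I(t)^⊥`, as `l < k` and `n` vary. -/
def classVector (k l n : ℕ) (c : ℂ) : H2 :=
  ∑' m : ℕ, classCoeff k l n c m • (lp.single 2 (m, n) (1 : ℂ) : H2)

lemma sqrt_wt_inv_le (m n : ℕ) : (√(wt m n))⁻¹ ≤ ((m + n).choose n : ℝ) := by
  have h1 : (1 : ℝ) ≤ ((m + n).choose n : ℝ) := by
    exact_mod_cast Nat.choose_pos (Nat.le_add_left n m)
  rw [wt, Nat.choose_symm_add, Real.sqrt_inv, inv_inv]
  rw [Real.sqrt_le_left (by positivity)]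
  nlinarith

lemma summable_bound {k : ℕ} (hk : 0 < k) {r : ℝ} (h0 : 0 < r) (h1 : r < 1) (n : ℕ) :
    Summable fun m : ℕ => r ^ (m / k) * ((m + n).choose n : ℝ) := by
  -- With `ρ ^ k = r`, the bound `r ^ (m / k) ≤ ρ ^ m / r` compares with the full binomial series.
  obtain ⟨ρ, hρ0, hρ1, hρ⟩ : ∃ ρ : ℝ, 0 < ρ ∧ ρ < 1 ∧ ρ ^ k = r :=
    ⟨r ^ ((k : ℝ)⁻¹), Real.rpow_pos_of_pos h0 _, Real.rpow_lt_one h0.le h1 (by positivity),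
      Real.rpow_inv_natCast_pow h0.le hk.ne'⟩
  refine ((summable_choose_mul_pow hρ0 hρ1 n).mul_left r⁻¹).of_nonneg_of_le
    (fun m => by positivity) fun m => ?_
  have hle : r ^ (m / k) * r ≤ ρ ^ m := by
    rw [← pow_succ, ← hρ, ← pow_mul]
    exact pow_le_pow_of_le_one hρ0.le hρ1.le (Nat.lt_mul_div_succ m hk).le
  rw [← le_div_iff₀ h0] at hle
  calc r ^ (m / k) * ((m + n).choose n : ℝ) ≤ ρ ^ m / r * ((m + n).choose n : ℝ) := by gcongr
    _ = _ := by ring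

lemma norm_classCoeff_smul_le {k : ℕ} (l n m : ℕ) {r : ℝ} {c : ℂ} (hc : ‖c‖ ≤ r) :
    ‖classCoeff k l n c m • (lp.single 2 (m, n) (1 : ℂ) : H2)‖
      ≤ r ^ (m / k) * ((m + n).choose n : ℝ) := by
  have hr : 0 ≤ r := (norm_nonneg _).trans hc
  rw [norm_smul, lp.norm_single (by norm_num), norm_one, mul_one, classCoeff]
  split_ifs
  · rw [norm_mul, norm_pow, norm_inv, Complex.norm_real, Real.norm_eq_abs,
      abs_of_nonneg (Real.sqrt_nonneg _)]
    exact mul_le_mul (pow_le_pow_left₀ (norm_nonneg _) hc _) (sqrt_wt_inv_le m n)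
      (by positivity) (by positivity)
  · rw [norm_zero]
    positivity

lemma classVector_apply {k : ℕ} (hk : 0 < k) (l n : ℕ) {c : ℂ} (hc : ‖c‖ < 1) (m n' : ℕ) :
    classVector k l n c (m, n') = if n' = n then classCoeff k l n c m else 0 := by
  obtain ⟨r, hr, hr1⟩ := exists_between hc
  have hs : Summable fun m : ℕ => classCoeff k l n c m • (lp.single 2 (m, n) (1 : ℂ) : H2) :=
    Summable.of_norm_bounded (summable_bound hk ((norm_nonneg _).trans_lt hr) hr1 n)
      fun m => norm_classCoeff_smul_le l n m hr.le
  have h := hs.hasSum.mapL (lp.evalCLM ℂ (fun _ : ℕ × ℕ => ℂ) 2 (m, n'))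
  refine h.unique ?_
  have hterm : ∀ m', lp.evalCLM ℂ (fun _ : ℕ × ℕ => ℂ) 2 (m, n')
      (classCoeff k l n c m' • (lp.single 2 (m', n) (1 : ℂ) : H2))
      = if m' = m then (if n' = n then classCoeff k l n c m else 0) else 0 := by
    intro m'
    change classCoeff k l n c m' * (lp.single 2 (m', n) (1 : ℂ) : H2) (m, n') = _
    by_cases hm : m' = m
    · subst hm
      rw [if_pos rfl]
      by_cases hn : n' = n
      · subst hn
        rw [lp.single_apply_self, mul_one, if_pos rfl]
      · rw [lp.single_apply_ne _ _ _ (by simpa using hn), mul_zero, if_neg hn]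
    · rw [if_neg hm, lp.single_apply_ne _ _ _ (fun h' => hm (Prod.ext_iff.1 h').1.symm), mul_zero]
  simp only [hterm]
  exact hasSum_ite_eq m _

/-- `classVector` is a locally uniform limit of polynomials in `c`; its analyticity makes the frame
smooth in `t`. -/
lemma analyticOnNhd_classVector {k : ℕ} (hk : 0 < k) (l n : ℕ) :
    AnalyticOnNhd ℂ (classVector k l n) (Metric.ball 0 1) := by
  refine DifferentiableOn.analyticOnNhd ?_ Metric.isOpen_ball
  intro c hc
  rw [mem_ball_zero_iff] at hc
  obtain ⟨r, hr, hr1⟩ := exists_between hc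
  have h := Complex.differentiableOn_tsum_of_summable_norm
    (F := fun (m : ℕ) c => classCoeff k l n c m • (lp.single 2 (m, n) (1 : ℂ) : H2))
    (U := Metric.ball (0 : ℂ) r)
    (summable_bound hk ((norm_nonneg _).trans_lt hr) hr1 n) (fun m => ?_) Metric.isOpen_ball
    (fun m c hc => norm_classCoeff_smul_le l n m (mem_ball_zero_iff.1 hc).le)
  · exact (h.differentiableAt (Metric.isOpen_ball.mem_nhds
      (mem_ball_zero_iff.2 hr))).differentiableWithinAt
  · refine DifferentiableOn.smul_const ?_ _
    unfold classCoeff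
    split_ifs <;> fun_prop

/-- The frame vector of the class `(l, n)` in the fibre `I(t)^⊥`. -/
def frame (k : ℕ) (ε : ℝ) (l n : ℕ) (t : ℝ) : H2 := classVector k l n (star (rootParam ε t))

lemma star_rootParam (ε t : ℝ) : star (rootParam ε t) = ε * Complex.exp (-(Complex.I * t)) := by
  rw [rootParam, star_mul', ← starRingEnd_apply, ← starRingEnd_apply, Complex.conj_ofReal,
    ← Complex.exp_conj, map_mul, Complex.conj_I, Complex.conj_ofReal, neg_mul]

lemma norm_star_rootParam {ε : ℝ} (h0 : 0 < ε) (t : ℝ) : ‖star (rootParam ε t)‖ = ε := by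
  rw [norm_star, rootParam, norm_mul, Complex.norm_real, Real.norm_eq_abs, abs_of_pos h0, mul_comm
    Complex.I, Complex.norm_exp_ofReal_mul_I, mul_one]

lemma hasDerivAt_star_rootParam (ε t : ℝ) :
    HasDerivAt (fun t => star (rootParam ε t)) (-Complex.I * star (rootParam ε t)) t := by
  simp only [star_rootParam]
  have h1 : HasDerivAt (fun t : ℝ => -(Complex.I * (t : ℂ))) (-Complex.I) t := by
    have := ((Complex.ofRealCLM.hasDerivAt (x := t)).const_mul Complex.I).fun_neg
    simpa using this
  refine (h1.cexp.const_mul (ε : ℂ)).congr_deriv ?_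
  ring

lemma contDiff_star_rootParam (ε : ℝ) :
    ContDiff ℝ ((⊤ : ℕ∞) : WithTop ℕ∞) fun t => star (rootParam ε t) := by
  simp only [star_rootParam]
  have : ContDiff ℝ ((⊤ : ℕ∞) : WithTop ℕ∞) fun t : ℝ => (t : ℂ) := Complex.ofRealCLM.contDiff
  fun_prop

lemma frame_apply {k : ℕ} (hk : 0 < k) {ε : ℝ} (h0 : 0 < ε) (h1 : ε < 1) (l n : ℕ) (t : ℝ)
    (m n' : ℕ) : frame k ε l n t (m, n')
      = if n' = n then classCoeff k l n (star (rootParam ε t)) m else 0 :=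
  classVector_apply hk l n (by rwa [norm_star_rootParam h0]) m n'

lemma frame_mem {k : ℕ} (hk : 0 < k) {ε : ℝ} (h0 : 0 < ε) (h1 : ε < 1) (l n : ℕ) (t : ℝ) :
    frame k ε l n t ∈ idealPerp (perturbedIdeal k ε t) := by
  rw [mem_idealPerp_iff]
  intro m n'
  rw [frame_apply hk h0 h1, frame_apply hk h0 h1]
  by_cases hn : n' = n
  · subst hn
    have hiff : m + k ≡ l [MOD k] ↔ m ≡ l [MOD k] := by simp [Nat.ModEq]
    simp only [if_true, classCoeff, hiff, Nat.add_div_right m hk]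
    split_ifs
    · rw [mul_left_comm, mul_inv_cancel₀ (sqrt_wt_ne_zero _ _), pow_succ]
      linear_combination (-(star (rootParam ε t) ^ (m / k) * star (rootParam ε t)))
        * mul_inv_cancel₀ (sqrt_wt_ne_zero m n')
    · simp
  · simp [hn]

lemma contDiff_frame {k : ℕ} (hk : 0 < k) {ε : ℝ} (h0 : 0 < ε) (h1 : ε < 1) (l n : ℕ) :
    ContDiff ℝ ((⊤ : ℕ∞) : WithTop ℕ∞) (frame k ε l n) := by
  have h : ContDiffOn ℂ ((⊤ : ℕ∞) : WithTop ℕ∞) (classVector k l n) (Metric.ball 0 1) :=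
    (analyticOnNhd_classVector hk l n).contDiffOn_of_completeSpace
  refine (h.restrict_scalars ℝ).comp_contDiff (contDiff_star_rootParam ε) fun t => ?_
  rw [mem_ball_zero_iff, norm_star_rootParam h0]
  exact h1

lemma hasDerivAt_frame {k : ℕ} (hk : 0 < k) {ε : ℝ} (h0 : 0 < ε) (h1 : ε < 1) (l n : ℕ) (t : ℝ) :
    HasDerivAt (frame k ε l n) (deriv (frame k ε l n) t) t :=
  ((contDiff_frame hk h0 h1 l n).differentiable (by simp)).differentiableAt.hasDerivAt

/-- The coefficients of the frame vectors are constant multiples of `(ε e^{-it}) ^ (m / k)`, so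
differentiation multiplies them by `-i * (m / k)`. -/
lemma deriv_frame_apply {k : ℕ} (hk : 0 < k) {ε : ℝ} (h0 : 0 < ε) (h1 : ε < 1) (l n : ℕ) (t : ℝ)
    (i : ℕ × ℕ) : deriv (frame k ε l n) t i
      = -Complex.I * ((i.1 / k : ℕ) : ℂ) * frame k ε l n t i := by
  obtain ⟨m, n'⟩ := i
  have h := (((lp.evalCLM ℂ (fun _ : ℕ × ℕ => ℂ) 2 (m, n')).restrictScalars ℝ).hasFDerivAt
    (x := frame k ε l n t)).comp_hasDerivAt t (hasDerivAt_frame hk h0 h1 l n t)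
  refine h.unique ?_
  have hfun : ((lp.evalCLM ℂ (fun _ : ℕ × ℕ => ℂ) 2 (m, n')).restrictScalars ℝ) ∘ frame k ε l n
      = fun t => if n' = n then classCoeff k l n (star (rootParam ε t)) m else 0 := by
    funext t
    exact frame_apply hk h0 h1 l n t m n'
  rw [hfun, frame_apply hk h0 h1]
  by_cases hn : n' = n
  · simp only [hn, if_true, classCoeff]
    split_ifs
    · refine (((hasDerivAt_star_rootParam ε t).fun_pow (m / k)).mul_const _).congr_deriv ?_
      rcases Nat.eq_zero_or_pos (m / k) with hj | hj
      · simp [hj]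
      · obtain ⟨j, hj⟩ := Nat.exists_eq_succ_of_ne_zero hj.ne'
        rw [hj, Nat.succ_eq_add_one, Nat.add_sub_cancel, pow_succ]
        ring
    · simpa using hasDerivAt_const t (0 : ℂ)
  · simpa [hn] using hasDerivAt_const t (0 : ℂ)

/-- The coefficient of a vector of the fibre with respect to the frame vector of the class
`(l, n)`. -/
def frameCoeff (k l n : ℕ) (v : H2) : ℂ := ((√(wt (l % k) n) : ℝ) : ℂ) * v (l % k, n)

/-- On the class `(l, n)`, a vector of the fibre is a multiple of the frame vector, so that pairings
with vectors supported on that class reduce to pairings with the frame vector. -/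
lemma inner_eq_frameCoeff_mul {k : ℕ} (hk : 0 < k) {ε : ℝ} (h0 : 0 < ε) (h1 : ε < 1)
    (l n : ℕ) (t : ℝ) {v : H2} (hv : v ∈ idealPerp (perturbedIdeal k ε t)) {w : H2}
    (hw : ∀ i, frame k ε l n t i = 0 → w i = 0) :
    inner ℂ w v = frameCoeff k l n v * inner ℂ w (frame k ε l n t) := by
  rw [lp.inner_eq_tsum, lp.inner_eq_tsum, ← tsum_mul_left]
  refine tsum_congr fun i => ?_
  by_cases hi : frame k ε l n t i = 0
  · simp [hw i hi]
  · obtain ⟨m, n'⟩ := i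
    rw [frame_apply hk h0 h1] at hi ⊢
    have hn : n' = n := by
      by_contra h
      exact hi (if_neg h)
    subst hn
    rw [if_pos rfl, classCoeff] at hi ⊢
    have hm : m ≡ l [MOD k] := by
      by_contra h
      exact hi (if_neg h)
    have hc := coeff_of_mem_idealPerp hv m n'
    rw [hm] at hc
    rw [if_pos hm, frameCoeff, RCLike.inner_apply, RCLike.inner_apply]
    have hv' : v (m, n') = (((√(wt (l % k) n') : ℝ) : ℂ) * v (l % k, n')) *
        (star (rootParam ε t) ^ (m / k) * ((√(wt m n') : ℝ) : ℂ)⁻¹) := by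
      field_simp [sqrt_wt_ne_zero m n']
      rw [mul_comm, hc]
      ring
    rw [hv']
    ring

lemma hasSum_inner_frame {k : ℕ} (hk : 0 < k) {ε : ℝ} (h0 : 0 < ε) (h1 : ε < 1) (l n : ℕ)
    (t : ℝ) (w : H2) : HasSum (fun m : ℕ => inner ℂ (w (m, n)) (frame k ε l n t (m, n)))
      (inner ℂ w (frame k ε l n t)) := by
  have hinj : Function.Injective fun m : ℕ => (m, n) := fun a b h => (Prod.ext_iff.1 h).1
  refine (hinj.hasSum_iff fun i hi => ?_).2 (lp.hasSum_inner w (frame k ε l n t))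
  obtain ⟨m, n'⟩ := i
  have hn : n' ≠ n := by
    rintro rfl
    exact hi ⟨m, rfl⟩
  rw [frame_apply hk h0 h1, if_neg hn, inner_zero_right]

lemma inner_frame_apply_self {k : ℕ} (hk : 0 < k) {ε : ℝ} (h0 : 0 < ε) (h1 : ε < 1) {F : ℝ}
    (hF : 0 < F) (hFk : F ^ k = ε ^ 2) {l : ℕ} (hl : l < k) (n : ℕ) (t : ℝ) (m : ℕ) :
    inner ℂ (frame k ε l n t (m, n)) (frame k ε l n t (m, n))
      = (((F ^ l)⁻¹ * (if m ≡ l [MOD k] then ((m + n).choose n : ℝ) * F ^ m else 0) : ℝ) : ℂ) := by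
  rw [frame_apply hk h0 h1, if_pos rfl, classCoeff, inner_self_eq_norm_sq_to_K]
  split_ifs with hm
  · rw [norm_mul, norm_pow, norm_star_rootParam h0, norm_inv, Complex.norm_real, Real.norm_eq_abs,
      abs_of_nonneg (Real.sqrt_nonneg _), ← RCLike.ofReal_pow, mul_pow, inv_pow,
      Real.sq_sqrt (wt_pos m n).le, wt, inv_inv, Nat.choose_symm_add, ← pow_mul,
      mul_comm (m / k), pow_mul, ← hFk, ← pow_mul]
    have e : k * (m / k) + l = m := by
      have := Nat.div_add_mod m k
      rwa [hm, Nat.mod_eq_of_lt hl] at this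
    conv_rhs => rw [← e, pow_add]
    rw [e]
    have hFl : F ^ l ≠ 0 := (pow_pos hF l).ne'
    refine congrArg Complex.ofReal ?_
    field_simp
    rfl
  · simp

lemma inner_frame_self {k : ℕ} (hk : 0 < k) {ε : ℝ} (h0 : 0 < ε) (h1 : ε < 1) {F : ℝ}
    (hF : 0 < F) (hF1 : F < 1) (hFk : F ^ k = ε ^ 2) {l : ℕ} (hl : l < k) (n : ℕ) (t : ℝ) :
    inner ℂ (frame k ε l n t) (frame k ε l n t) = (((F ^ l)⁻¹ * classSum k F l n : ℝ) : ℂ) := by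
  have h := hasSum_inner_frame hk h0 h1 l n t (frame k ε l n t)
  simp only [inner_frame_apply_self hk h0 h1 hF hFk hl] at h
  exact h.unique (Complex.hasSum_ofReal.2 ((hasSum_classSum k hF hF1 l n).mul_left _))

lemma inner_frame_self_ne_zero {k : ℕ} (hk : 0 < k) {ε : ℝ} (h0 : 0 < ε) (h1 : ε < 1) {F : ℝ}
    (hF : 0 < F) (hF1 : F < 1) (hFk : F ^ k = ε ^ 2) {l : ℕ} (hl : l < k) (n : ℕ) (t : ℝ) :
    (inner ℂ (frame k ε l n t) (frame k ε l n t) : ℂ) ≠ 0 := by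
  rw [inner_frame_self hk h0 h1 hF hF1 hFk hl]
  have := classSum_pos (k := k) hF hF1 l n
  exact Complex.ofReal_ne_zero.2 (by positivity)

/-- The connection is diagonal in the frame, with connection coefficient `classMean`. -/
lemma inner_deriv_frame {k : ℕ} (hk : 0 < k) {ε : ℝ} (h0 : 0 < ε) (h1 : ε < 1) {F : ℝ}
    (hF : 0 < F) (hF1 : F < 1) (hFk : F ^ k = ε ^ 2) {l : ℕ} (hl : l < k) (n : ℕ) (t : ℝ) :
    inner ℂ (deriv (frame k ε l n) t) (frame k ε l n t)
      = Complex.I * (classMean k F l n : ℝ) * inner ℂ (frame k ε l n t) (frame k ε l n t) := by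
  have hS := (classSum_pos (k := k) hF hF1 l n).ne'
  have h := hasSum_inner_frame hk h0 h1 l n t (deriv (frame k ε l n) t)
  have hR := (Complex.hasSum_ofReal.2
    ((hasSum_classMoment hk hF hF1 l n).mul_left (F ^ l)⁻¹)).mul_left Complex.I
  have heq := h.unique (hR.congr_fun fun m => ?_)
  · rw [heq, inner_frame_self hk h0 h1 hF hF1 hFk hl, classMean, mul_assoc, ← Complex.ofReal_mul]
    congr 2
    field_simp
  · rw [deriv_frame_apply hk h0 h1, ← smul_eq_mul, inner_smul_left,
      inner_frame_apply_self hk h0 h1 hF hFk hl, map_mul, map_neg, Complex.conj_I, neg_neg,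
      Complex.conj_natCast, mul_assoc]
    congr 1
    rw [← Complex.ofReal_natCast, ← Complex.ofReal_mul]
    congr 1
    split_ifs <;> ring

lemma eq_of_frameCoeff_eq {k : ℕ} (hk : 0 < k) {ε t : ℝ} {v w : H2}
    (hv : v ∈ idealPerp (perturbedIdeal k ε t)) (hw : w ∈ idealPerp (perturbedIdeal k ε t))
    (h : ∀ l < k, ∀ n, frameCoeff k l n v = frameCoeff k l n w) : v = w := by
  ext ⟨m, n⟩
  have h' := h (m % k) (Nat.mod_lt _ hk) n
  rw [frameCoeff, frameCoeff, Nat.mod_mod] at h'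
  have hv' := coeff_of_mem_idealPerp hv m n
  rw [h', ← coeff_of_mem_idealPerp hw] at hv'
  exact mul_left_cancel₀ (sqrt_wt_ne_zero m n) hv'

/-! ### Flat sections and parallel transport -/

/-- The holonomy phase `exp (i s μ)` along a path of length `s`, with `μ` the class mean. -/
def phase (k : ℕ) (F s : ℝ) (i : ℕ × ℕ) : ℂ :=
  Complex.exp (((s * classMean k F i.1 i.2 : ℝ) : ℂ) * Complex.I)

lemma norm_phase (k : ℕ) (F s : ℝ) (i : ℕ × ℕ) : ‖phase k F s i‖ = 1 :=
  Complex.norm_exp_ofReal_mul_I _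

lemma phase_congr {k : ℕ} (F s : ℝ) {l l' : ℕ} (h : l ≡ l' [MOD k]) (n : ℕ) :
    phase k F s (l, n) = phase k F s (l', n) := by
  simp only [phase, classMean_congr F h]

lemma phase_zero (k : ℕ) (F : ℝ) (i : ℕ × ℕ) : phase k F 0 i = 1 := by simp [phase]

lemma star_phase (k : ℕ) (F s : ℝ) (i : ℕ × ℕ) : star (phase k F s i) = phase k F (-s) i := by
  rw [phase, phase, ← starRingEnd_apply, ← Complex.exp_conj, map_mul, Complex.conj_ofReal,
    Complex.conj_I]
  congr 1
  push_cast
  ring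

lemma star_phase_mul_self (k : ℕ) (F s : ℝ) (i : ℕ × ℕ) :
    star (phase k F s i) * phase k F s i = 1 := by
  rw [star_phase, phase, phase, ← Complex.exp_add]
  rw [← add_mul, ← Complex.ofReal_add, neg_mul, neg_add_cancel]
  simp

lemma isClassMultiplier_phase (k : ℕ) (F s : ℝ) : IsClassMultiplier k (phase k F s) where
  bounded := ⟨1, fun i => (norm_phase k F s i).le⟩
  periodic m n := phase_congr F s (by simp [Nat.ModEq]) n

lemma hasDerivAt_phase (k : ℕ) (F s : ℝ) (i : ℕ × ℕ) :
    HasDerivAt (fun s => phase k F s i)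
      (Complex.I * (classMean k F i.1 i.2 : ℝ) * phase k F s i) s := by
  simp only [phase, Complex.ofReal_mul]
  have h : HasDerivAt (fun s : ℝ => (s : ℂ) * (classMean k F i.1 i.2 : ℝ) * Complex.I)
      ((classMean k F i.1 i.2 : ℝ) * Complex.I) s := by
    simpa using ((Complex.ofRealCLM.hasDerivAt (x := s)).mul_const
      ((classMean k F i.1 i.2 : ℝ) : ℂ)).mul_const Complex.I
  refine h.cexp.congr_deriv ?_
  ring

lemma contDiff_phase (k : ℕ) (F : ℝ) (i : ℕ × ℕ) :
    ContDiff ℝ ((⊤ : ℕ∞) : WithTop ℕ∞) fun s => phase k F s i := by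
  simp only [phase, Complex.ofReal_mul]
  have : ContDiff ℝ ((⊤ : ℕ∞) : WithTop ℕ∞) fun t : ℝ => (t : ℂ) := Complex.ofRealCLM.contDiff
  fun_prop

lemma deriv_frame_eq_zero {k : ℕ} (hk : 0 < k) {ε : ℝ} (h0 : 0 < ε) (h1 : ε < 1) (l n : ℕ)
    (t : ℝ) (i : ℕ × ℕ) (hi : frame k ε l n t i = 0) : deriv (frame k ε l n) t i = 0 := by
  rw [deriv_frame_apply hk h0 h1, hi, mul_zero]

/-- The frame vectors, rotated by their holonomy phase, are flat. -/
lemma isFlatSection_phase_smul_frame {k : ℕ} (hk : 0 < k) {ε : ℝ} (h0 : 0 < ε) (h1 : ε < 1)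
    {F : ℝ} (hF : 0 < F) (hF1 : F < 1) (hFk : F ^ k = ε ^ 2) {l : ℕ} (hl : l < k) (n : ℕ) :
    IsFlatSection k ε fun t => phase k F t (l, n) • frame k ε l n t where
  smooth := (contDiff_phase k F (l, n)).smul (contDiff_frame hk h0 h1 l n)
  mem_fibre t := Submodule.smul_mem _ _ (frame_mem hk h0 h1 l n t)
  covariantDeriv_eq_zero t := by
    have hd : deriv (fun t => phase k F t (l, n) • frame k ε l n t) t = _ :=
      ((hasDerivAt_phase k F t (l, n)).smul (hasDerivAt_frame hk h0 h1 l n t)).deriv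
    rw [Submodule.orthogonalProjectionOnto_eq_zero_iff, Submodule.mem_orthogonal']
    intro v hv
    rw [hd, inner_eq_frameCoeff_mul hk h0 h1 l n t hv, inner_add_left, inner_smul_left,
      inner_smul_left, inner_deriv_frame hk h0 h1 hF hF1 hFk hl, map_mul, map_mul,
      Complex.conj_I, Complex.conj_ofReal]
    · ring
    · intro i hi
      change _ * deriv (frame k ε l n) t i + _ * frame k ε l n t i = 0
      rw [hi, deriv_frame_eq_zero hk h0 h1 l n t i hi, mul_zero, mul_zero, add_zero]

/-- Along a flat section, the pairing with a frame vector only picks up the holonomy phase. -/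
lemma inner_frame_flatSection {k : ℕ} (hk : 0 < k) {ε : ℝ} (h0 : 0 < ε) (h1 : ε < 1)
    {F : ℝ} (hF : 0 < F) (hF1 : F < 1) (hFk : F ^ k = ε ^ 2) {l : ℕ} (hl : l < k) (n : ℕ)
    {ξ : ℝ → H2} (hξ : IsFlatSection k ε ξ) (t : ℝ) :
    inner ℂ (frame k ε l n t) (ξ t)
      = phase k F t (l, n) * inner ℂ (frame k ε l n 0) (ξ 0) := by
  have hder : ∀ t, HasDerivAt (fun t => inner ℂ (frame k ε l n t) (ξ t))
      (Complex.I * (classMean k F l n : ℝ) * inner ℂ (frame k ε l n t) (ξ t)) t := by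
    intro t
    have hξ' : HasDerivAt ξ (deriv ξ t) t :=
      (hξ.smooth.differentiable (by simp)).differentiableAt.hasDerivAt
    refine ((hasDerivAt_frame hk h0 h1 l n t).inner ℂ hξ').congr_deriv ?_
    have hz : inner ℂ (frame k ε l n t) (deriv ξ t) = 0 :=
      (Submodule.mem_orthogonal _ _).1
        (Submodule.orthogonalProjectionOnto_eq_zero_iff.1 (hξ.covariantDeriv_eq_zero t)) _
        (frame_mem hk h0 h1 l n t)
    rw [hz, zero_add, inner_eq_frameCoeff_mul hk h0 h1 l n t (hξ.mem_fibre t)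
      (deriv_frame_eq_zero hk h0 h1 l n t), inner_deriv_frame hk h0 h1 hF hF1 hFk hl,
      inner_eq_frameCoeff_mul hk h0 h1 l n t (hξ.mem_fibre t) fun _ h => h]
    ring
  -- The pairing solves a scalar linear equation; dividing by the phase makes it constant.
  have hconst : ∀ t, HasDerivAt
      (fun t => star (phase k F t (l, n)) * inner ℂ (frame k ε l n t) (ξ t)) 0 t := by
    intro t
    refine ((hasDerivAt_phase k F t (l, n)).star.mul (hder t)).congr_deriv ?_
    rw [star_mul', star_mul', ← starRingEnd_apply, ← starRingEnd_apply, Complex.conj_I,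
      Complex.conj_ofReal]
    ring
  have h := is_const_of_deriv_eq_zero (fun t => (hconst t).differentiableAt)
    (fun t => (hconst t).deriv) t 0
  simp only [phase_zero, star_one, one_mul] at h
  rw [← h, ← mul_assoc, mul_comm (phase k F t (l, n)), star_phase_mul_self, one_mul]

lemma rootParam_two_pi (ε : ℝ) : rootParam ε (2 * Real.pi) = rootParam ε 0 := by
  have : Complex.I * ((2 * Real.pi : ℝ) : ℂ) = 2 * Real.pi * Complex.I := by
    push_cast
    ring
  rw [rootParam, rootParam, this, Complex.exp_two_pi_mul_I]
  simp

lemma frame_two_pi (k : ℕ) (ε : ℝ) (l n : ℕ) :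
    frame k ε l n (2 * Real.pi) = frame k ε l n 0 := by
  rw [frame, frame, rootParam_two_pi]

lemma mem_fibre_two_pi {k : ℕ} {ε : ℝ} {v : H2} :
    v ∈ idealPerp (perturbedIdeal k ε (2 * Real.pi)) ↔ v ∈ idealPerp (perturbedIdeal k ε 0) := by
  rw [mem_idealPerp_iff, mem_idealPerp_iff, rootParam_two_pi]

/-- The parallel transport along the loop, as a diagonal operator. -/
def transport (k : ℕ) (ε F : ℝ) :
    idealPerp (perturbedIdeal k ε 0) →L[ℂ] idealPerp (perturbedIdeal k ε 0) :=
  fibreDiag k ε 0 _ (isClassMultiplier_phase k F (2 * Real.pi))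

lemma isMonodromy_transport {k : ℕ} (hk : 0 < k) {ε : ℝ} (h0 : 0 < ε) (h1 : ε < 1)
    {F : ℝ} (hF : 0 < F) (hF1 : F < 1) (hFk : F ^ k = ε ^ 2) :
    IsMonodromy k ε (transport k ε F) := by
  intro ξ hξ
  refine eq_of_frameCoeff_eq hk (Subtype.property _)
    (mem_fibre_two_pi.1 (hξ.mem_fibre (2 * Real.pi))) fun l hl n => ?_
  have h := inner_frame_flatSection hk h0 h1 hF hF1 hFk hl n hξ (2 * Real.pi)
  rw [inner_eq_frameCoeff_mul hk h0 h1 l n _ (hξ.mem_fibre _) fun _ h => h,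
    inner_eq_frameCoeff_mul hk h0 h1 l n _ (hξ.mem_fibre _) fun _ h => h, frame_two_pi,
    ← mul_assoc] at h
  rw [mul_right_cancel₀ (inner_frame_self_ne_zero hk h0 h1 hF hF1 hFk hl n 0) h, frameCoeff,
    frameCoeff, Nat.mod_eq_of_lt hl, transport, fibreDiag_apply]
  ring

/-- The frame vectors are complete in the fibre and extend to flat sections, so the monodromy
operator is determined. -/
lemma IsMonodromy.eq_transport {k : ℕ} (hk : 0 < k) {ε : ℝ} (h0 : 0 < ε) (h1 : ε < 1)
    {F : ℝ} (hF : 0 < F) (hF1 : F < 1) (hFk : F ^ k = ε ^ 2)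
    {U : idealPerp (perturbedIdeal k ε 0) →L[ℂ] idealPerp (perturbedIdeal k ε 0)}
    (hU : IsMonodromy k ε U) : U = transport k ε F := by
  set s : Set (idealPerp (perturbedIdeal k ε 0)) :=
    {v | ∃ l < k, ∃ n, (v : H2) = frame k ε l n 0} with hs
  have hdense : Dense (Submodule.span ℂ s : Set (idealPerp (perturbedIdeal k ε 0))) := by
    rw [Submodule.dense_iff_topologicalClosure_eq_top, Submodule.topologicalClosure_eq_top_iff,
      Submodule.eq_bot_iff]
    intro v hv
    refine Subtype.ext (eq_of_frameCoeff_eq hk v.2 (Submodule.zero_mem _) fun l hl n => ?_)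
    have h := (Submodule.mem_orthogonal _ _).1 hv ⟨frame k ε l n 0, frame_mem hk h0 h1 l n 0⟩
      (Submodule.subset_span ⟨l, hl, n, rfl⟩)
    rw [Submodule.coe_inner, inner_eq_frameCoeff_mul hk h0 h1 l n 0 v.2 fun _ h => h] at h
    rw [(mul_eq_zero.1 h).resolve_right (inner_frame_self_ne_zero hk h0 h1 hF hF1 hFk hl n 0)]
    simp [frameCoeff]
  refine ContinuousLinearMap.ext_on hdense ?_
  rintro v ⟨l, hl, n, hv⟩
  have hflat := isFlatSection_phase_smul_frame hk h0 h1 hF hF1 hFk hl n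
  have e : v = ⟨_, hflat.mem_fibre 0⟩ := Subtype.ext (by simp only [hv, phase_zero, one_smul])
  rw [e]
  exact Subtype.ext ((hU _ hflat).trans (isMonodromy_transport hk h0 h1 hF hF1 hFk _ hflat).symm)

/-! ### Conjugation by the monodromy operator -/

lemma transport_mem_unitary (k : ℕ) (ε F : ℝ) :
    transport k ε F ∈ unitary
      (idealPerp (perturbedIdeal k ε 0) →L[ℂ] idealPerp (perturbedIdeal k ε 0)) := by
  rw [Unitary.mem_iff]
  constructor
  · ext v i
    rw [transport, star_fibreDiag, mul_apply_eq_comp, fibreDiag_apply, fibreDiag_apply,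
      ← mul_assoc, star_phase_mul_self, one_mul]
    rfl
  · ext v i
    rw [transport, star_fibreDiag, mul_apply_eq_comp, fibreDiag_apply, fibreDiag_apply,
      ← mul_assoc, mul_comm (phase _ _ _ _), star_phase_mul_self, one_mul]
    rfl

/-- The eigenvalues of the diagonal operator that compares a phase-conjugated shift in the
direction `j` with the scalar multiple by `c` of that shift. -/
def defect (k : ℕ) (F s : ℝ) (j : ℕ × ℕ) (c : ℂ) (i : ℕ × ℕ) : ℂ :=
  star (phase k F s i) * phase k F s (i + j) - c

lemma isClassMultiplier_defect (k : ℕ) (F s : ℝ) (j : ℕ × ℕ) (c : ℂ) :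
    IsClassMultiplier k (defect k F s j c) where
  bounded := ⟨1 + ‖c‖, fun i => (norm_sub_le _ _).trans (by
    rw [norm_mul, norm_star, norm_phase, norm_phase, one_mul])⟩
  periodic m n := by
    obtain ⟨a, b⟩ := j
    have h : m + k + a ≡ m + a [MOD k] := by
      rw [add_right_comm]
      simp [Nat.ModEq]
    have h' : m + k ≡ m [MOD k] := by simp [Nat.ModEq]
    simp only [defect, Prod.mk_add_mk, phase_congr F s h, phase_congr F s h']

lemma tendsto_defect {k : ℕ} {F s x : ℝ} {j : ℕ × ℕ} {c : ℂ} {l : ℕ}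
    (hx : Filter.Tendsto
      (fun n => classMean k F ((l, n) + j).1 ((l, n) + j).2 - classMean k F l n)
      Filter.atTop (nhds x))
    (hc : c = Complex.exp (((s * x : ℝ) : ℂ) * Complex.I)) :
    Filter.Tendsto (fun n => defect k F s j c (l, n)) Filter.atTop (nhds 0) := by
  have hcont : Continuous fun y : ℝ => Complex.exp (((s * y : ℝ) : ℂ) * Complex.I) := by fun_prop
  have h := ((hcont.tendsto x).comp hx).sub_const c
  rw [← hc, sub_self] at h
  refine h.congr fun n => ?_
  simp only [Function.comp_apply, defect]
  rw [star_phase, phase, phase, ← Complex.exp_add, ← add_mul, ← Complex.ofReal_add]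
  congr 4
  ring

/-- Under a shift of the first index the class means change asymptotically by `-1 / k`, or by
`1 - 1 / k` where the class wraps around; both give the same phase. -/
lemma tendsto_defect_fst {k : ℕ} (hk : 0 < k) {F : ℝ} (hF : 0 < F) (hF1 : F < 1) {l : ℕ}
    (hl : l < k) :
    Filter.Tendsto (fun n => defect k F (2 * Real.pi) (1, 0)
      (Complex.exp (-(2 * Real.pi / k * Complex.I))) (l, n)) Filter.atTop (nhds 0) := by
  have hk' : (k : ℝ) ≠ 0 := by positivity
  have hkc : (k : ℂ) ≠ 0 := by exact_mod_cast hk.ne'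
  have hlim : ∀ l' < k, Filter.Tendsto (fun n => classMean k F l' n - classMean k F l n)
      Filter.atTop (nhds (((l : ℝ) - l') / k)) := by
    intro l' hl'
    have h := (((tendsto_classMean hk hF hF1 hl').sub (tendsto_classMean hk hF hF1 hl)).add_const
      ((l : ℝ) - l')).div_const (k : ℝ)
    simp only [sub_zero, zero_add] at h
    refine h.congr fun n => ?_
    field_simp
    ring
  rcases Nat.lt_or_ge (l + 1) k with h | h
  · refine tendsto_defect (x := ((l : ℝ) - (l + 1 : ℕ)) / k) (hlim (l + 1) h) ?_
    congr 1
    push_cast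
    ring
  · have hlk : l + 1 = k := le_antisymm hl h
    have hcongr : ∀ n, classMean k F (l + 1) n = classMean k F 0 n := fun n =>
      classMean_congr F (by simp [Nat.ModEq, hlk]) n
    refine tendsto_defect (x := ((l : ℝ) - (0 : ℕ)) / k) ?_ ?_
    · simp only [Prod.mk_add_mk, add_zero, hcongr]
      exact hlim 0 hk
    · have hl' : (l : ℝ) = k - 1 := by
        rw [← hlk]
        push_cast
        ring
      have e : ((2 * Real.pi * (((l : ℝ) - (0 : ℕ)) / k) : ℝ) : ℂ) * Complex.I
          = -(2 * Real.pi / k * Complex.I) + 2 * Real.pi * Complex.I := by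
        rw [hl']
        push_cast
        field_simp
        ring
      rw [e, Complex.exp_add, Complex.exp_two_pi_mul_I, mul_one]

/-- Under a shift of the second index the class means grow asymptotically by
`F / (k * (1 - F))`. -/
lemma tendsto_defect_snd {k : ℕ} (hk : 0 < k) {F : ℝ} (hF : 0 < F) (hF1 : F < 1) {l : ℕ}
    (hl : l < k) :
    Filter.Tendsto (fun n => defect k F (2 * Real.pi) (0, 1)
      (Complex.exp (2 * Real.pi * F / (k * (1 - F)) * Complex.I)) (l, n))
      Filter.atTop (nhds 0) := by
  have hk' : (k : ℝ) ≠ 0 := by positivity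
  have hF' : 1 - F ≠ 0 := by linarith
  refine tendsto_defect (x := F / (1 - F) / k) ?_ ?_
  · have h := tendsto_classMean hk hF hF1 hl
    have h' := (((h.comp (Filter.tendsto_add_atTop_nat 1)).sub h).add_const
      (F / (1 - F))).div_const (k : ℝ)
    simp only [sub_zero, zero_add] at h'
    refine h'.congr fun n => ?_
    simp only [Function.comp_apply, Prod.mk_add_mk, add_zero]
    push_cast
    rw [div_eq_iff hk']
    ring
  · congr 2
    push_cast
    rw [div_div, mul_comm (1 - (F : ℂ)), mul_div_assoc]

/-- As the adjoint of `T₁` is a backward shift, it is conjugated into itself up to a diagonal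
factor. -/
lemma star_transport_mul_star_T₁ (k : ℕ) (ε F : ℝ) (c : ℂ) :
    star (transport k ε F) * star (T₁ (perturbedIdeal k ε 0)) * transport k ε F
        - c • star (T₁ (perturbedIdeal k ε 0))
      = fibreDiag k ε 0 _ (isClassMultiplier_defect k F (2 * Real.pi) (1, 0) c)
        * star (T₁ (perturbedIdeal k ε 0)) := by
  ext v ⟨m, n⟩
  rw [transport, star_fibreDiag, mul_apply_eq_comp, fibreDiag_apply, star_T₁_apply]
  change star (phase k F (2 * Real.pi) (m, n)) *
    (star (T₁ (perturbedIdeal k ε 0)) (fibreDiag k ε 0 _ _ v) : H2) (m, n)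
    - c * (star (T₁ (perturbedIdeal k ε 0)) v : H2) (m, n) = _
  rw [star_T₁_apply, star_T₁_apply, fibreDiag_apply, defect, Prod.mk_add_mk, add_zero]
  ring

lemma star_transport_mul_star_T₂ (k : ℕ) (ε F : ℝ) (c : ℂ) :
    star (transport k ε F) * star (T₂ (perturbedIdeal k ε 0)) * transport k ε F
        - c • star (T₂ (perturbedIdeal k ε 0))
      = fibreDiag k ε 0 _ (isClassMultiplier_defect k F (2 * Real.pi) (0, 1) c)
        * star (T₂ (perturbedIdeal k ε 0)) := by
  ext v ⟨m, n⟩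
  rw [transport, star_fibreDiag, mul_apply_eq_comp, fibreDiag_apply, star_T₂_apply]
  change star (phase k F (2 * Real.pi) (m, n)) *
    (star (T₂ (perturbedIdeal k ε 0)) (fibreDiag k ε 0 _ _ v) : H2) (m, n)
    - c * (star (T₂ (perturbedIdeal k ε 0)) v : H2) (m, n) = _
  rw [star_T₂_apply, star_T₂_apply, fibreDiag_apply, defect, Prod.mk_add_mk, add_zero]
  ring

/-- If conjugation by `U` changes `star A` to a multiple of it plus `D * star A`, with `D` and `star D`
compact, then `A` and `star A` are both eigenvectors of the conjugation up to compact operators. -/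
lemma isCompactOperator_conj_sub {E : Type*} [NormedAddCommGroup E] [InnerProductSpace ℂ E]
    [CompleteSpace E] {U A D : E →L[ℂ] E} {c : ℂ} (hD : IsCompactOperator D)
    (hD' : IsCompactOperator (star D : E →L[ℂ] E))
    (h : star U * star A * U - c • star A = D * star A) :
    IsCompactOperator (star U * A * U - star c • A) ∧
      IsCompactOperator (star U * star A * U - c • star A) := by
  constructor
  · have h' : star U * A * U - star c • A = A * star D := by
      have := congrArg star h
      rwa [star_mul, star_star, star_sub, star_smul, star_mul, star_mul, star_star,
        star_star, ← mul_assoc] at this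
    rw [h']
    exact hD'.clm_comp A
  · rw [h]
    exact hD.comp_clm (star A)

lemma isCompactOperator_star_fibreDiag {k : ℕ} (hk : 0 < k) {ε t : ℝ} {d : ℕ × ℕ → ℂ}
    (hd : IsClassMultiplier k d)
    (hlim : ∀ l < k, Filter.Tendsto (fun n => d (l, n)) Filter.atTop (nhds 0)) :
    IsCompactOperator (star (fibreDiag k ε t d hd) :
      idealPerp (perturbedIdeal k ε t) →L[ℂ] idealPerp (perturbedIdeal k ε t)) := by
  rw [star_fibreDiag]
  refine isCompactOperator_fibreDiag hk hd.conj fun l hl => ?_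
  have := (hlim l hl).star
  rwa [star_zero] at this

/-- Conjugation by a unitary `U` preserves the C*-algebra generated by a set and the compact
operators as soon as it maps the generating set into that algebra. -/
lemma conj_mem_cstarGenerated {E : Type*} [NormedAddCommGroup E] [InnerProductSpace ℂ E]
    [CompleteSpace E] {s : Set (E →L[ℂ] E)} {U : E →L[ℂ] E} (hU : U ∈ unitary (E →L[ℂ] E))
    (hs : ∀ A ∈ s, star U * A * U ∈ cstarGenerated E s) {A : E →L[ℂ] E}
    (hA : A ∈ cstarGenerated E s) : star U * A * U ∈ cstarGenerated E s := by
  have hUU : U * star U = 1 := (Unitary.mem_iff.1 hU).2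
  have hcomp : ∀ K : E →L[ℂ] E, IsCompactOperator K → K ∈ cstarGenerated E s := fun K hK =>
    StarSubalgebra.le_topologicalClosure _ (StarAlgebra.subset_adjoin ℂ _ (Or.inr hK))
  have hadj : ∀ A ∈ StarAlgebra.adjoin ℂ (s ∪ {K : E →L[ℂ] E | IsCompactOperator K}),
      star U * A * U ∈ cstarGenerated E s := by
    intro A hA
    induction hA using StarAlgebra.adjoin_induction with
    | mem A hA =>
      rcases hA with hA | hA
      · exact hs A hA
      · exact hcomp _ ((IsCompactOperator.clm_comp hA (star U)).comp_clm U)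
    | algebraMap c =>
      rw [← Algebra.commutes, mul_assoc, (Unitary.mem_iff.1 hU).1, mul_one]
      exact algebraMap_mem _ c
    | add A B _ _ hA hB =>
      rw [mul_add, add_mul]
      exact add_mem hA hB
    | mul A B _ _ hA hB =>
      have : star U * (A * B) * U = (star U * A * U) * (star U * B * U) := by
        calc star U * (A * B) * U = star U * A * 1 * B * U := by simp only [mul_one, mul_assoc]
          _ = _ := by rw [← hUU]; simp only [mul_assoc]
      rw [this]
      exact mul_mem hA hB
    | star A _ hA =>
      have := star_mem hA
      rwa [star_mul, star_mul, star_star, ← mul_assoc] at this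
  have hclosed : IsClosed {A : E →L[ℂ] E | star U * A * U ∈ cstarGenerated E s} :=
    (StarSubalgebra.isClosed_topologicalClosure _).preimage (by fun_prop)
  exact closure_minimal hadj hclosed hA

lemma mem_cstarGenerated_of_sub_smul {E : Type*} [NormedAddCommGroup E] [InnerProductSpace ℂ E]
    [CompleteSpace E] {s : Set (E →L[ℂ] E)} {A B : E →L[ℂ] E} {c : ℂ} (hA : A ∈ s)
    (h : IsCompactOperator (B - c • A)) : B ∈ cstarGenerated E s := by
  have h1 : B - c • A ∈ cstarGenerated E s :=
    StarSubalgebra.le_topologicalClosure _ (StarAlgebra.subset_adjoin ℂ _ (Or.inr h))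
  have h2 : A ∈ cstarGenerated E s :=
    StarSubalgebra.le_topologicalClosure _ (StarAlgebra.subset_adjoin ℂ _ (Or.inl hA))
  have := add_mem h1 (SMulMemClass.smul_mem c h2)
  rwa [sub_add_cancel] at this

lemma star_exp_ofReal_mul_I (x : ℝ) :
    star (Complex.exp (x * Complex.I)) = Complex.exp (-(x * Complex.I)) := by
  rw [← starRingEnd_apply, ← Complex.exp_conj, map_mul, Complex.conj_ofReal, Complex.conj_I,
    mul_neg]

end DruryArveson

end

open DruryArveson in
theorem mainTheorem4 (k : ℕ) (hk : 0 < k) (ε : ℝ) (hε₀ : 0 < ε) (hε₁ : ε < 1)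
    (F : ℝ) (hF : F = ε ^ ((2 : ℝ) / (k : ℝ))) :
    (∃! U : idealPerp (perturbedIdeal k ε 0) →L[ℂ] idealPerp (perturbedIdeal k ε 0),
      IsMonodromy k ε U) ∧
    ∀ U : idealPerp (perturbedIdeal k ε 0) →L[ℂ] idealPerp (perturbedIdeal k ε 0),
      IsMonodromy k ε U →
        U ∈ unitary
          (idealPerp (perturbedIdeal k ε 0) →L[ℂ] idealPerp (perturbedIdeal k ε 0)) ∧
        (∀ A ∈ toeplitzAlgebra (perturbedIdeal k ε 0),
          star U * A * U ∈ toeplitzAlgebra (perturbedIdeal k ε 0)) ∧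
        IsCompactOperator
          (star U * T₁ (perturbedIdeal k ε 0) * U
            - Complex.exp (2 * Real.pi / k * Complex.I) • T₁ (perturbedIdeal k ε 0)) ∧
        IsCompactOperator
          (star U * star (T₁ (perturbedIdeal k ε 0)) * U
            - Complex.exp (-(2 * Real.pi / k * Complex.I)) •
              star (T₁ (perturbedIdeal k ε 0))) ∧
        IsCompactOperator
          (star U * T₂ (perturbedIdeal k ε 0) * U
            - Complex.exp (-(2 * Real.pi * F / (k * (1 - F)) * Complex.I)) •
              T₂ (perturbedIdeal k ε 0)) ∧
        IsCompactOperator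
          (star U * star (T₂ (perturbedIdeal k ε 0)) * U
            - Complex.exp (2 * Real.pi * F / (k * (1 - F)) * Complex.I) •
              star (T₂ (perturbedIdeal k ε 0))) := by
  have hk' : (0 : ℝ) < k := by exact_mod_cast hk
  have hF0 : 0 < F := hF ▸ Real.rpow_pos_of_pos hε₀ _
  have hF1 : F < 1 := hF ▸ Real.rpow_lt_one hε₀.le hε₁ (by positivity)
  have hFk : F ^ k = ε ^ 2 := by
    rw [hF, ← Real.rpow_natCast, ← Real.rpow_mul hε₀.le, div_mul_cancel₀ _ hk'.ne']
    exact Real.rpow_two ε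
  refine ⟨⟨transport k ε F, isMonodromy_transport hk hε₀ hε₁ hF0 hF1 hFk,
    fun U hU => hU.eq_transport hk hε₀ hε₁ hF0 hF1 hFk⟩, fun U hU => ?_⟩
  obtain rfl := hU.eq_transport hk hε₀ hε₁ hF0 hF1 hFk
  have hunit := transport_mem_unitary k ε F
  obtain ⟨h₁, h₁'⟩ := isCompactOperator_conj_sub
    (isCompactOperator_fibreDiag hk (isClassMultiplier_defect k F (2 * Real.pi) (1, 0) _)
      fun l hl => tendsto_defect_fst hk hF0 hF1 hl)
    (isCompactOperator_star_fibreDiag hk _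
      fun l hl => tendsto_defect_fst hk hF0 hF1 hl)
    (star_transport_mul_star_T₁ k ε F _)
  obtain ⟨h₂, h₂'⟩ := isCompactOperator_conj_sub
    (isCompactOperator_fibreDiag hk (isClassMultiplier_defect k F (2 * Real.pi) (0, 1) _)
      fun l hl => tendsto_defect_snd hk hF0 hF1 hl)
    (isCompactOperator_star_fibreDiag hk _
      fun l hl => tendsto_defect_snd hk hF0 hF1 hl)
    (star_transport_mul_star_T₂ k ε F _)
  have e₁ : star (Complex.exp (-(2 * Real.pi / k * Complex.I)))
      = Complex.exp (2 * Real.pi / k * Complex.I) := by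
    have := star_exp_ofReal_mul_I (2 * Real.pi / k)
    push_cast at this
    rw [← this, star_star]
  have e₂ : star (Complex.exp (2 * Real.pi * F / (k * (1 - F)) * Complex.I))
      = Complex.exp (-(2 * Real.pi * F / (k * (1 - F)) * Complex.I)) := by
    have := star_exp_ofReal_mul_I (2 * Real.pi * F / (k * (1 - F)))
    push_cast at this
    exact this
  rw [e₁] at h₁
  rw [e₂] at h₂
  refine ⟨hunit, fun A hA => conj_mem_cstarGenerated hunit ?_ hA, h₁, h₁', h₂, h₂'⟩
  rintro A (rfl | rfl)
  · exact mem_cstarGenerated_of_sub_smul (Or.inl rfl) h₁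
  · exact mem_cstarGenerated_of_sub_smul (Or.inr rfl) h₂
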